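/- Setting. Let $T$ be a tree with vertex set $V$ and geodesic distance $d$, with a fixed half-infinite geodesic $g=(g_n)_{n\ge 0}$, $g_0=o$. The level of $x\in V$ is $\ell(x)=d(o,\Pi(x))-d(\Pi(x),x)$, where $\Pi(x)$ is the point of $g$ closest to $x$; write $y\le x$ if $\ell(x)-\ell(y)=d(x,y)$; the sons of $x$ are the neighbours $y$ of $x$ with $\ell(y)=\ell(x)-1$. Let $m:V\to(0,\infty)$ be a flow, i.e. $m(x)=\sum_{y\text{ son of }x}m(y)$ for all $x$, which is locally doubling as a measure, i.e. for every integer $r>0$ there is $C_r>1$ with $m(B_{2r}(x))\le C_r\,m(B_r(x))$ for all $x\in V$. Fix $\beta\ge 12$. For $x_0\in V$ and integers $h''>h'\ge 1$ let $R_{h'}^{h''}(x_0)=\{x\le x_0:\ \ell(x_0)-h''<\ell(x)\le \ell(x_0)-h'\}$. The family $\mathcal R$ of admissible trapezoids consists of all singletons and all $R_{h'}^{h''}(x_0)$ with $2\le h''/h'\le\beta$; for $R=R_{h'}^{h''}(x_0)$ put $R^*=\{x\in V:\ d(x,R)<h'\}$. (For singletons the integrals below vanish and no $R^*$ is needed.)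 A $(1,\infty)$-atom is a function $a:V\to\mathbb C$ supported in some $R\in\mathcal R$ with $\|a\|_\infty\le 1/m(R)$ and $\int_R a\,dm=0$. $H^1(m)$ is the space of all $f\in L^1(m)$ of the form $f=\sum_j\lambda_ja_j$ with $(1,\infty)$-atoms $a_j$ and $\sum_j|\lambda_j|<\infty$, and $\|f\|_{H^1}$ is the infimum of $\sum_j|\lambda_j|$ over all such representations. $BMO(m)$ is the space of all $f:V\to\mathbb C$ with $\|f\|_{BMO}=\sup_{R\in\mathcal R}\frac1{m(R)}\int_R|f-f_R|\,dm<\infty$, $f_R=\frac1{m(R)}\int_R f\,dm$, modulo constants. Theorem. Let $A$ be a bounded linear operator on $L^2(m)$ with kernel $K:V\times V\to\mathbb C$, i.e. $Af(x)=\sum_{y}K(x,y)f(y)m(y)$ for finitely supported $f$. (i) If $$\sup_{R\in\mathcal R}\ \sup_{y,z\in R}\int_{(R^*)^c}|K(x,y)-K(x,z)|\,dm(x)<\infty,$$ then $A$ extends to a bounded operator from $H^1(m)$ to $L^1(m)$, and to a bounded operator on $L^p(m)$ for every $1<p<2$. (ii) If $$\sup_{R\in\mathcal R}\ \sup_{y,z\in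 R}\int_{(R^*)^c}|K(y,x)-K(z,x)|\,dm(x)<\infty,$$ then $A$ extends to a bounded operator from $L^\infty(m)$ to $BMO(m)$, and to a bounded operator on $L^q(m)$ for every $2<q<\infty$. Here "extends to a bounded operator from $X$ to $Y$" means that there is a bounded linear operator $X\to Y$ that coincides with $A$ on $L^2(m)\cap X$. -/

import Mathlib

open MeasureTheory Set
open scoped ENNReal NNReal

noncomputable section

/-- A tree with root at infinity: a tree together with a half-infinite geodesic
`ray 0, ray 1, ...`; the origin is `ray 0` and the root is the boundary point that the ray
represents. No restriction is made on the degrees of the vertices. -/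
structure TreeAtInfinity (V : Type*) where
  /-- the edge relation -/
  graph : SimpleGraph V
  isTree : graph.IsTree
  /-- the distinguished half-infinite geodesic -/
  ray : ℕ → V
  ray_geodesic : ∀ i k : ℕ, graph.dist (ray i) (ray (i + k)) = k

namespace TreeAtInfinity

variable {V : Type*} (T : TreeAtInfinity V)

/-- The index along the ray of the projection of `x` on the ray, i.e. of the point of the ray
closest to `x`. -/
def projIndex (x : V) : ℕ :=
  Function.argmin (fun k : ℕ => T.graph.dist x (T.ray k))

/-- The projection of `x` on the ray. -/
def proj (x : V) : V := T.ray (T.projIndex x)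

/-- The level of `x`: the distance of the projection of `x` from the origin, minus the distance
of `x` from its projection. -/
def level (x : V) : ℤ :=
  (T.graph.dist (T.ray 0) (T.proj x) : ℤ) - (T.graph.dist (T.proj x) x : ℤ)

/-- `y ≤ x` in the order induced by the root at infinity. -/
def Below (y x : V) : Prop := T.level x - T.level y = (T.graph.dist x y : ℤ)

/-- The sons of `x`: the neighbours of `x` one level below it. -/
def sons (x : V) : Set V := {y | T.graph.Adj y x ∧ T.level y = T.level x - 1}

/-- The closed ball of radius `r` centred at `x` for the geodesic distance. -/
def ball (x : V) (r : ℕ) : Set V := {y | T.graph.dist y x ≤ r}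

/-- Strictly positive flows: the mass of each vertex is the sum of the masses of its sons. -/
def IsFlow (m : V → ℝ) : Prop :=
  (∀ x, 0 < m x) ∧ ∀ x, HasSum (fun y : T.sons x => m y) (m x)

/-- The trapezoid with root `x` and parameters `a < b`: the vertices `y ≤ x` with
`level x - b < level y ≤ level x - a`. -/
def trapezoid (x : V) (a b : ℕ) : Set V :=
  {y | T.Below y x ∧ T.level x - (b : ℤ) < T.level y ∧ T.level y ≤ T.level x - (a : ℤ)}

/-- The enlargement `R* = {y | d(y, R) < a}` of the trapezoid `R` with root `x` and
parameters `a < b`. -/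
def enlargement (x : V) (a b : ℕ) : Set V :=
  {y | ∃ z ∈ T.trapezoid x a b, T.graph.dist y z < a}

end TreeAtInfinity

/-- Admissible parameters of a trapezoid: positive integers `a < b` with `2 ≤ b / a ≤ β`. -/
def AdmissibleParams (β : ℝ) (a b : ℕ) : Prop :=
  0 < a ∧ a < b ∧ 2 ≤ (b : ℝ) / (a : ℝ) ∧ (b : ℝ) / (a : ℝ) ≤ β

/-- The family of admissible trapezoids: all singletons, and all trapezoids with admissible
parameters. -/
def TreeAtInfinity.admissible {V : Type*} (T : TreeAtInfinity V) (β : ℝ) : Set (Set V) :=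
  {R | (∃ x, R = {x}) ∨ ∃ x a b, AdmissibleParams β a b ∧ R = T.trapezoid x a b}

variable {V : Type*} [MeasurableSpace V]

/-- The measure on `V` with mass `m x` at each vertex `x`. -/
def vertexMeasure (m : V → ℝ) : Measure V :=
  Measure.sum fun x => ENNReal.ofReal (m x) • Measure.dirac x

/-- Locally doubling: for each radius `r > 0` there is a constant `C` with
`m(B(x, 2r)) ≤ C m(B(x, r))` for all vertices `x`. -/
def TreeAtInfinity.IsLocallyDoubling (T : TreeAtInfinity V) (m : V → ℝ) : Prop :=
  ∀ r : ℕ, 0 < r → ∃ C : ℝ≥0, 1 < C ∧ ∀ x,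
    vertexMeasure m (T.ball x (2 * r)) ≤ C * vertexMeasure m (T.ball x r)

/-! ### The Hardy space -/

/-- A `(1, ∞)`-atom: an element of `L¹` supported in an admissible trapezoid `R`, bounded
by `1 / m(R)`, and with vanishing integral. -/
def IsHardyAtom (T : TreeAtInfinity V) (m : V → ℝ) (β : ℝ) (a : Lp ℂ 1 (vertexMeasure m)) : Prop :=
  ∃ R ∈ T.admissible β,
    (∀ᵐ x ∂(vertexMeasure m), x ∉ R → a x = 0) ∧
    eLpNorm a ∞ (vertexMeasure m) ≤ (vertexMeasure m R)⁻¹ ∧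
    ∫ x in R, a x ∂(vertexMeasure m) = 0

/-- `g = ∑ c j • a j` in `L¹`, with `(1, ∞)`-atoms `a j` and absolutely summable
coefficients `c j`. -/
def IsAtomicDecomposition (T : TreeAtInfinity V) (m : V → ℝ) (β : ℝ)
    (g : Lp ℂ 1 (vertexMeasure m)) (c : ℕ → ℂ) (a : ℕ → Lp ℂ 1 (vertexMeasure m)) : Prop :=
  (∀ j, IsHardyAtom T m β (a j)) ∧ Summable (fun j => ‖c j‖) ∧ HasSum (fun j => c j • a j) g

theorem isHardyAtom_zero (T : TreeAtInfinity V) (m : V → ℝ) (β : ℝ) : IsHardyAtom T m β 0 := by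
  refine ⟨{T.ray 0}, Or.inl ⟨_, rfl⟩, ?_, ?_, ?_⟩
  · filter_upwards [Lp.coeFn_zero ℂ 1 (vertexMeasure m)] with x hx _ using by simpa using hx
  · rw [eLpNorm_congr_ae (Lp.coeFn_zero ℂ 1 (vertexMeasure m))]; simp
  · rw [integral_congr_ae (ae_restrict_of_ae (Lp.coeFn_zero ℂ 1 (vertexMeasure m)))]; simp

theorem isAtomicDecomposition_zero (T : TreeAtInfinity V) (m : V → ℝ) (β : ℝ) :
    IsAtomicDecomposition T m β 0 (fun _ => 0) (fun _ => 0) :=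
  ⟨fun _ => isHardyAtom_zero T m β, by simp, by simp⟩

theorem IsAtomicDecomposition.smul {T : TreeAtInfinity V} {m : V → ℝ} {β : ℝ}
    {g : Lp ℂ 1 (vertexMeasure m)} {c : ℕ → ℂ} {a : ℕ → Lp ℂ 1 (vertexMeasure m)}
    (h : IsAtomicDecomposition T m β g c a) (t : ℂ) :
    IsAtomicDecomposition T m β (t • g) (fun j => t * c j) a :=
  ⟨h.1, by simpa using h.2.1.mul_left ‖t‖, by simpa [mul_smul] using h.2.2.const_smul t⟩

theorem IsAtomicDecomposition.add {T : TreeAtInfinity V} {m : V → ℝ} {β : ℝ}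
    {g g₁ : Lp ℂ 1 (vertexMeasure m)} {c c₁ : ℕ → ℂ} {a a₁ : ℕ → Lp ℂ 1 (vertexMeasure m)}
    (h : IsAtomicDecomposition T m β g c a) (h₁ : IsAtomicDecomposition T m β g₁ c₁ a₁) :
    ∃ c₂ a₂, IsAtomicDecomposition T m β (g + g₁) c₂ a₂ ∧
      ∑' j, ‖c₂ j‖ = ∑' j, ‖c j‖ + ∑' j, ‖c₁ j‖ := by
  have hn : HasSum (Sum.elim (fun j => ‖c j‖) (fun j => ‖c₁ j‖))
      (∑' j, ‖c j‖ + ∑' j, ‖c₁ j‖) :=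
    HasSum.sum (by simpa [Function.comp_def] using h.2.1.hasSum)
      (by simpa [Function.comp_def] using h₁.2.1.hasSum)
  have hs : HasSum (Sum.elim (fun j => c j • a j) (fun j => c₁ j • a₁ j)) (g + g₁) :=
    HasSum.sum (by simpa [Function.comp_def] using h.2.2)
      (by simpa [Function.comp_def] using h₁.2.2)
  let e := Equiv.natSumNatEquivNat.symm
  have hn₂ : HasSum (fun j => ‖Sum.elim c c₁ (e j)‖) (∑' j, ‖c j‖ + ∑' j, ‖c₁ j‖) := by
    convert e.hasSum_iff.2 hn using 2 with j
    rcases h : e j with i | i <;> simp [h]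
  have hs₂ : HasSum (fun j => Sum.elim c c₁ (e j) • Sum.elim a a₁ (e j)) (g + g₁) := by
    convert e.hasSum_iff.2 hs using 2 with j
    rcases h : e j with i | i <;> simp [h]
  refine ⟨fun j => Sum.elim c c₁ (e j), fun j => Sum.elim a a₁ (e j), ⟨fun j => ?_,
    hn₂.summable, hs₂⟩, hn₂.tsum_eq⟩
  rcases h' : e j with i | i
  · simpa [h'] using h.1 i
  · simpa [h'] using h₁.1 i

/-- The subspace of `L¹` underlying the Hardy space `H¹`: the functions with an atomic
decomposition. -/
def hardySubmodule (T : TreeAtInfinity V) (m : V → ℝ) (β : ℝ) :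
    Submodule ℂ (Lp ℂ 1 (vertexMeasure m)) where
  carrier := {g | ∃ c a, IsAtomicDecomposition T m β g c a}
  zero_mem' := ⟨_, _, isAtomicDecomposition_zero T m β⟩
  add_mem' := by
    rintro g g₁ ⟨c, a, h⟩ ⟨c₁, a₁, h₁⟩
    obtain ⟨c₂, a₂, h₂, -⟩ := h.add h₁
    exact ⟨c₂, a₂, h₂⟩
  smul_mem' := by
    rintro t g ⟨c, a, h⟩
    exact ⟨_, _, h.smul t⟩

/-- The norm on `H¹`: the infimum of `∑ |c j|` over all atomic decompositions. -/
def hardyNorm (T : TreeAtInfinity V) (m : V → ℝ) (β : ℝ) (g : Lp ℂ 1 (vertexMeasure m)) : ℝ :=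
  sInf {s | ∃ c a, IsAtomicDecomposition T m β g c a ∧ s = ∑' j, ‖c j‖}

/-- The Hardy space `H¹`. This is a separate type from the subspace of `L¹`, as it carries
another norm. -/
def HardySpace (T : TreeAtInfinity V) (m : V → ℝ) (β : ℝ) : Type _ :=
  ↥(hardySubmodule T m β)

namespace HardySpace

variable {T : TreeAtInfinity V} {m : V → ℝ} {β : ℝ}

instance : AddCommGroup (HardySpace T m β) := inferInstanceAs (AddCommGroup ↥(hardySubmodule T m β))

instance : Module ℂ (HardySpace T m β) := inferInstanceAs (Module ℂ ↥(hardySubmodule T m β))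

/-- The inclusion of `H¹` in `L¹`. -/
def toL1 : HardySpace T m β →ₗ[ℂ] Lp ℂ 1 (vertexMeasure m) := (hardySubmodule T m β).subtype

instance : Norm (HardySpace T m β) := ⟨fun g => hardyNorm T m β (toL1 g)⟩

theorem norm_def (g : HardySpace T m β) : ‖g‖ = hardyNorm T m β (toL1 g) := rfl

theorem exists_decomposition (g : HardySpace T m β) :
    ∃ c a, IsAtomicDecomposition T m β (toL1 g) c a := g.2

theorem norm_le {g : HardySpace T m β} {c : ℕ → ℂ} {a : ℕ → Lp ℂ 1 (vertexMeasure m)}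
    (h : IsAtomicDecomposition T m β (toL1 g) c a) : ‖g‖ ≤ ∑' j, ‖c j‖ := by
  refine csInf_le ⟨0, ?_⟩ ⟨c, a, h, rfl⟩
  rintro s ⟨c, a, -, rfl⟩
  exact tsum_nonneg fun _ => norm_nonneg _

theorem le_norm {g : HardySpace T m β} {r : ℝ}
    (h : ∀ c a, IsAtomicDecomposition T m β (toL1 g) c a → r ≤ ∑' j, ‖c j‖) : r ≤ ‖g‖ := by
  obtain ⟨c, a, hg⟩ := exists_decomposition g
  refine le_csInf ⟨_, c, a, hg, rfl⟩ ?_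
  rintro s ⟨c, a, hc, rfl⟩
  exact h c a hc

theorem norm_smul_le_aux (t : ℂ) (g : HardySpace T m β) : ‖t • g‖ ≤ ‖t‖ * ‖g‖ := by
  by_cases ht : t = 0
  · subst ht
    have h0 : toL1 ((0 : ℂ) • g) = 0 := by simp
    have h := isAtomicDecomposition_zero T m β
    rw [← h0] at h
    simpa using norm_le h
  · have hpos : 0 < ‖t‖ := norm_pos_iff.2 ht
    rw [← div_le_iff₀' hpos]
    refine le_norm fun c a h => ?_
    rw [div_le_iff₀' hpos]
    have h2 := h.smul t
    rw [← map_smul] at h2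
    simpa [tsum_mul_left] using norm_le h2

theorem core : SeminormedSpace.Core ℂ (HardySpace T m β) where
  norm_nonneg g := le_norm fun _ _ _ => tsum_nonneg fun _ => norm_nonneg _
  norm_smul t g := by
    refine le_antisymm (norm_smul_le_aux t g) ?_
    by_cases ht : t = 0
    · subst ht
      simpa using le_norm (g := (0 : ℂ) • g) (r := 0)
        fun _ _ _ => tsum_nonneg fun _ => norm_nonneg _
    · have h := norm_smul_le_aux t⁻¹ (t • g)
      rw [inv_smul_smul₀ ht, norm_inv] at h
      rwa [← le_inv_mul_iff₀ (norm_pos_iff.2 ht)]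
  norm_triangle g g₁ := by
    rw [← sub_le_iff_le_add]
    refine le_norm fun c a h => ?_
    rw [sub_le_iff_le_add, ← sub_le_iff_le_add']
    refine le_norm fun c₁ a₁ h₁ => ?_
    rw [sub_le_iff_le_add']
    obtain ⟨c₂, a₂, h₂, hs⟩ := h.add h₁
    rw [← map_add] at h₂
    exact (norm_le h₂).trans hs.le

instance : SeminormedAddCommGroup (HardySpace T m β) := SeminormedAddCommGroup.ofCore core

instance : NormedSpace ℂ (HardySpace T m β) where
  norm_smul_le t g := (core.norm_smul t g).le

end HardySpace

/-! ### The space BMO -/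

/-- The mean oscillation of `f` on `R`: the average over `R` of `|f - f_R|`, where `f_R` is the
average of `f` over `R`. -/
def meanOscillation (m : V → ℝ) (R : Set V) (f : V → ℂ) : ℝ≥0∞ :=
  ⨍⁻ x in R, ‖f x - ⨍ y in R, f y ∂(vertexMeasure m)‖ₑ ∂(vertexMeasure m)

/-- The supremum of the mean oscillations of `f` on the admissible trapezoids. -/
def bmoENorm (T : TreeAtInfinity V) (m : V → ℝ) (β : ℝ) (f : V → ℂ) : ℝ≥0∞ :=
  ⨆ R ∈ T.admissible β, meanOscillation m R f

theorem integral_oscillation_add [DiscreteMeasurableSpace V] (ν : Measure V) [IsFiniteMeasure ν]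
    (f g : V → ℂ) :
    ∫⁻ x, ‖(f + g) x - ∫ y, (f + g) y ∂ν‖ₑ ∂ν ≤
      ∫⁻ x, ‖f x - ∫ y, f y ∂ν‖ₑ ∂ν + ∫⁻ x, ‖g x - ∫ y, g y ∂ν‖ₑ ∂ν := by
  have key : ∀ u : V → ℂ, ∫⁻ x, ‖u x - ∫ y, u y ∂ν‖ₑ ∂ν ≠ ∞ → Integrable u ν := by
    intro u hu
    have h1 : Integrable (fun x => u x - ∫ y, u y ∂ν) ν :=
      ⟨(Measurable.of_discrete).aestronglyMeasurable, hu.lt_top⟩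
    refine (h1.add (integrable_const (∫ y, u y ∂ν))).congr (ae_of_all _ fun x => ?_)
    simp
  by_cases hf : ∫⁻ x, ‖f x - ∫ y, f y ∂ν‖ₑ ∂ν = ∞
  · simp [hf]
  by_cases hg : ∫⁻ x, ‖g x - ∫ y, g y ∂ν‖ₑ ∂ν = ∞
  · simp [hg]
  have hi : ∫ y, (f + g) y ∂ν = ∫ y, f y ∂ν + ∫ y, g y ∂ν :=
    integral_add (key f hf) (key g hg)
  rw [← lintegral_add_left Measurable.of_discrete, hi]
  refine lintegral_mono fun x => ?_
  rw [Pi.add_apply, add_sub_add_comm]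
  exact enorm_add_le _ _

theorem meanOscillation_add [DiscreteMeasurableSpace V] (m : V → ℝ) (R : Set V) (f g : V → ℂ) :
    meanOscillation m R (f + g) ≤ meanOscillation m R f + meanOscillation m R g := by
  have : IsFiniteMeasure (((vertexMeasure m).restrict R univ)⁻¹ • (vertexMeasure m).restrict R) :=
    ⟨by simpa using (ENNReal.inv_mul_le_one _).trans_lt ENNReal.one_lt_top⟩
  exact integral_oscillation_add _ f g

theorem meanOscillation_smul [DiscreteMeasurableSpace V] (m : V → ℝ) (R : Set V) (t : ℂ)
    (f : V → ℂ) : meanOscillation m R (t • f) = ‖t‖ₑ * meanOscillation m R f := by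
  simp only [meanOscillation, laverage, average, Pi.smul_apply]
  rw [integral_smul, ← lintegral_const_mul _ Measurable.of_discrete]
  simp only [← smul_sub, enorm_smul]

theorem bmoENorm_add [DiscreteMeasurableSpace V] (T : TreeAtInfinity V) (m : V → ℝ) (β : ℝ)
    (f g : V → ℂ) : bmoENorm T m β (f + g) ≤ bmoENorm T m β f + bmoENorm T m β g :=
  iSup₂_le fun R hR => (meanOscillation_add m R f g).trans
    (add_le_add (le_iSup₂ (f := fun R _ => meanOscillation m R f) R hR)
      (le_iSup₂ (f := fun R _ => meanOscillation m R g) R hR))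

theorem bmoENorm_smul [DiscreteMeasurableSpace V] (T : TreeAtInfinity V) (m : V → ℝ) (β : ℝ)
    (t : ℂ) (f : V → ℂ) : bmoENorm T m β (t • f) = ‖t‖ₑ * bmoENorm T m β f := by
  simp only [bmoENorm, meanOscillation_smul, ENNReal.mul_iSup]

variable [DiscreteMeasurableSpace V]

/-- The functions of bounded mean oscillation. -/
def bmoSubmodule (T : TreeAtInfinity V) (m : V → ℝ) (β : ℝ) : Submodule ℂ (V → ℂ) where
  carrier := {f | bmoENorm T m β f < ∞}
  zero_mem' := by
    have h := bmoENorm_smul T m β 0 0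
    rw [zero_smul, enorm_zero, zero_mul] at h
    simp [h]
  add_mem' hf hg := (bmoENorm_add T m β _ _).trans_lt (ENNReal.add_lt_top.2 ⟨hf, hg⟩)
  smul_mem' t f hf := by
    change bmoENorm T m β (t • f) < ∞
    rw [bmoENorm_smul]
    exact ENNReal.mul_lt_top enorm_lt_top hf

/-- The seminormed space of functions of bounded mean oscillation, before the quotient by the
constants. -/
def BMOFun (T : TreeAtInfinity V) (m : V → ℝ) (β : ℝ) : Type _ := ↥(bmoSubmodule T m β)

namespace BMOFun

variable {T : TreeAtInfinity V} {m : V → ℝ} {β : ℝ}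

instance : AddCommGroup (BMOFun T m β) := inferInstanceAs (AddCommGroup ↥(bmoSubmodule T m β))

instance : Module ℂ (BMOFun T m β) := inferInstanceAs (Module ℂ ↥(bmoSubmodule T m β))

/-- The underlying function. -/
def toFun : BMOFun T m β →ₗ[ℂ] (V → ℂ) := (bmoSubmodule T m β).subtype

instance : Norm (BMOFun T m β) := ⟨fun f => (bmoENorm T m β (toFun f)).toReal⟩

theorem norm_def (f : BMOFun T m β) : ‖f‖ = (bmoENorm T m β (toFun f)).toReal := rfl

theorem core : SeminormedSpace.Core ℂ (BMOFun T m β) where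
  norm_nonneg _ := ENNReal.toReal_nonneg
  norm_smul t f := by simp [norm_def, bmoENorm_smul]
  norm_triangle f g := by
    have hf : bmoENorm T m β (toFun f) ≠ ∞ := ne_of_lt f.2
    have hg : bmoENorm T m β (toFun g) ≠ ∞ := ne_of_lt g.2
    rw [norm_def, norm_def, norm_def, ← ENNReal.toReal_add hf hg, map_add]
    exact ENNReal.toReal_mono (ENNReal.add_ne_top.2 ⟨hf, hg⟩) (bmoENorm_add T m β _ _)

instance : SeminormedAddCommGroup (BMOFun T m β) := SeminormedAddCommGroup.ofCore core

instance : NormedSpace ℂ (BMOFun T m β) where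
  norm_smul_le t f := (core.norm_smul t f).le

/-- The constant functions. -/
def constants (T : TreeAtInfinity V) (m : V → ℝ) (β : ℝ) : Submodule ℂ (BMOFun T m β) where
  carrier := {f | ∃ t : ℂ, toFun f = fun _ => t}
  zero_mem' := ⟨0, by rw [map_zero]; rfl⟩
  add_mem' := by
    rintro f g ⟨s, hs⟩ ⟨t, ht⟩
    exact ⟨s + t, by rw [map_add, hs, ht]; rfl⟩
  smul_mem' := by
    rintro t f ⟨s, hs⟩
    exact ⟨t * s, by rw [map_smul, hs]; rfl⟩

end BMOFun

/-- The space `BMO`: the functions of bounded mean oscillation modulo the constants, with the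
quotient norm (functions that differ by a constant have the same seminorm). -/
abbrev BMO (T : TreeAtInfinity V) (m : V → ℝ) (β : ℝ) : Type _ :=
  BMOFun T m β ⧸ BMOFun.constants T m β

/-! ### Integral operators -/

/-- `A` has kernel `K` with respect to the measure `m`:
`A f (x) = ∑ y, K x y * f y * m y` for all finitely supported `f`. -/
def HasKernel (m : V → ℝ) (A : Lp ℂ 2 (vertexMeasure m) →L[ℂ] Lp ℂ 2 (vertexMeasure m))
    (K : V → V → ℂ) : Prop :=
  ∀ f : Lp ℂ 2 (vertexMeasure m), (Function.support f).Finite →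
    A f =ᵐ[vertexMeasure m] fun x => ∫ y, K x y * f y ∂(vertexMeasure m)

/-- The supremum, over the admissible trapezoids `R` and over `y, z ∈ R`, of
`∫ |K x y - K x z| dm(x)` over the complement of `R*`. Singletons are left out, as the integrand
vanishes for `y = z`. -/
def hormanderConst (T : TreeAtInfinity V) (m : V → ℝ) (β : ℝ) (K : V → V → ℂ) : ℝ≥0∞ :=
  ⨆ (x₀ : V) (a : ℕ) (b : ℕ) (_ : AdmissibleParams β a b)
    (y ∈ T.trapezoid x₀ a b) (z ∈ T.trapezoid x₀ a b),
    ∫⁻ x in (T.enlargement x₀ a b)ᶜ, ‖K x y - K x z‖ₑ ∂(vertexMeasure m)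

end

/-! This is Calderón–Zygmund theory with trapezoids in the role of cubes. The flow condition makes
every generation below `x` carry mass `m x`, so a trapezoid has mass `(b - a) * m x` and its
enlargement at most three times as much (`IsFlow.measure_trapezoid`,
`IsFlow.measure_enlargement_le`). Local doubling makes the mass of a father comparable to that of
each son; hence the tree is locally finite and countable.

The core is a stopping-time argument, `hasCZDecomposition_trapezoid`. A trapezoid on which the
average of `|f|` is small is cut into admissible trapezoids of comparable mass, or finally into
vertices. Where the average exceeds `t`, `f` is replaced by its mean; the Hörmander condition
controls the image of the remainder off the enlargement. With the `L²` bound this gives weak type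
`(1, 1)` (`IsFlow.isWeakTypeOne`), and Marcinkiewicz interpolation gives `1 < p < 2`. For `q > 2`
the same argument is applied to the transposed kernel and dualized (`IsStrongType.transpose`).

All extensions are explicit integrals, so no density argument is needed. Boundedness on `Lᵖ` puts
each row `K x ·` in the dual space, and weak type `(1, 1)` makes each row bounded; in both cases the
integral converges absolutely. Agreement with `A` holds since the kernel represents `A` pointwise on
all of `L²` (`apply_eq_kernelOp`). On `H¹` the bounded rows allow passing from atoms to sums of
atoms. On `L^∞` the integral is taken with `K x y - K o y`, which is integrable in `y` and changes
the result only by a constant. -/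

/-! ### Levels and fathers in a tree with root at infinity. -/

/-- Geodesics from `u` prolonged through `w` and through `w'` are both paths to `v`; paths in a tree
are unique, so their penultimate vertices agree. -/
theorem SimpleGraph.IsTree.eq_of_adj_of_dist_lt {V : Type*} {G : SimpleGraph V} (hG : G.IsTree)
    {u v w w' : V} (hw : G.Adj w v) (hw' : G.Adj w' v) (h : G.dist u v = G.dist u w + 1)
    (h' : G.dist u v = G.dist u w' + 1) : w = w' := by
  obtain ⟨p, -, hp⟩ := hG.connected.exists_path_of_dist u w
  obtain ⟨q, -, hq⟩ := hG.connected.exists_path_of_dist u w'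
  have h1 : (p.concat hw).IsPath := SimpleGraph.Walk.isPath_of_length_eq_dist _ (by simp [hp, h])
  have h2 : (q.concat hw').IsPath := SimpleGraph.Walk.isPath_of_length_eq_dist _ (by simp [hq, h'])
  have h3 := congrArg SimpleGraph.Walk.penultimate ((hG.existsUnique_path u v).unique h1 h2)
  simpa using h3

theorem SimpleGraph.IsTree.exists_adj_dist_lt {V : Type*} {G : SimpleGraph V} (hG : G.IsTree)
    {u v : V} (h : u ≠ v) : ∃ w, G.Adj v w ∧ G.dist u v = G.dist u w + 1 := by
  obtain ⟨p, hp⟩ := hG.connected.exists_walk_length_eq_dist v u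
  cases p with
  | nil => exact absurd rfl h
  | @cons _ w _ hadj q =>
    refine ⟨w, hadj, ?_⟩
    have h1 : G.dist w u ≤ q.length := SimpleGraph.dist_le q
    rw [SimpleGraph.Walk.length_cons, SimpleGraph.dist_comm] at hp
    rw [SimpleGraph.dist_comm] at h1
    rcases hG.dist_eq_dist_add_one_of_adj u hadj with h2 | h2 <;> omega

namespace TreeAtInfinity

variable {V : Type*} (T : TreeAtInfinity V)

theorem adj_ray (k : ℕ) : T.graph.Adj (T.ray k) (T.ray (k + 1)) :=
  SimpleGraph.dist_eq_one_iff_adj.1 (T.ray_geodesic k 1)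

/-- Along an edge the distance to `x` changes by exactly one, and at the projection it cannot drop.
If it dropped at a later step, a ray vertex would have both its ray neighbours closer to `x`; they
would coincide, which contradicts that the ray is geodesic. -/
theorem dist_ray_add (x : V) (k : ℕ) :
    T.graph.dist x (T.ray (T.projIndex x + k)) = T.graph.dist x (T.ray (T.projIndex x)) + k := by
  have key : ∀ k, T.graph.dist x (T.ray (T.projIndex x + k + 1)) =
      T.graph.dist x (T.ray (T.projIndex x + k)) + 1 := by
    intro k
    induction k with
    | zero =>
      have h0 := Function.argmin_le (fun k : ℕ => T.graph.dist x (T.ray k)) (T.projIndex x + 1)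
      change T.graph.dist x (T.ray (T.projIndex x)) ≤ _ at h0
      rcases T.isTree.dist_eq_dist_add_one_of_adj x (T.adj_ray (T.projIndex x)) with h | h
      · omega
      · exact h
    | succ k ih =>
      rcases T.isTree.dist_eq_dist_add_one_of_adj x (T.adj_ray (T.projIndex x + (k + 1)))
        with h | h
      · exfalso
        have h3 := T.isTree.eq_of_adj_of_dist_lt (T.adj_ray (T.projIndex x + k))
            (T.adj_ray (T.projIndex x + k + 1)).symm ih h
        have h4 := T.ray_geodesic (T.projIndex x + k) 2
        rw [h3, add_assoc (T.projIndex x + k) 1 1] at h4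
        simp at h4
      · exact h
  induction k with
  | zero => rfl
  | succ k ih => rw [← add_assoc, key, ih]; rfl

/-- The level is a Busemann function: any ray point beyond the projection computes it. Levels of
several vertices can thus be compared through one common far ray point. -/
theorem level_eq {x : V} {k : ℕ} (hk : T.projIndex x ≤ k) :
    T.level x = k - T.graph.dist x (T.ray k) := by
  obtain ⟨j, rfl⟩ := Nat.exists_eq_add_of_le hk
  have h0 := T.ray_geodesic 0 (T.projIndex x)
  rw [zero_add] at h0
  rw [level, proj, h0, T.dist_ray_add, SimpleGraph.dist_comm]
  push_cast
  ring

theorem projIndex_ray (k : ℕ) : T.projIndex (T.ray k) = k := by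
  have h := Function.argmin_le (fun j : ℕ => T.graph.dist (T.ray k) (T.ray j)) k
  change T.graph.dist (T.ray k) (T.ray (T.projIndex (T.ray k))) ≤ _ at h
  simp only [SimpleGraph.dist_self, nonpos_iff_eq_zero] at h
  rcases le_total k (T.projIndex (T.ray k)) with h1 | h1 <;>
    obtain ⟨j, hj⟩ := Nat.exists_eq_add_of_le h1
  · rw [hj, T.ray_geodesic] at h
    omega
  · have h2 := T.ray_geodesic (T.projIndex (T.ray k)) j
    rw [← hj, SimpleGraph.dist_comm, h] at h2
    omega

theorem level_ray (k : ℕ) : T.level (T.ray k) = k := by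
  rw [T.level_eq (k := k) (T.projIndex_ray k).le]
  simp

theorem level_adj {x y : V} (h : T.graph.Adj x y) :
    T.level x = T.level y + 1 ∨ T.level y = T.level x + 1 := by
  rw [T.level_eq (le_max_left (T.projIndex x) (T.projIndex y)),
    T.level_eq (le_max_right (T.projIndex x) (T.projIndex y))]
  rcases T.isTree.dist_eq_dist_add_one_of_adj (T.ray (max (T.projIndex x) (T.projIndex y))) h
    with h1 | h1 <;> rw [SimpleGraph.dist_comm (v := x), SimpleGraph.dist_comm (v := y)] at h1 <;>
    omega

/-- The father is the neighbour towards a ray point beyond the projection of `x`. -/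
theorem exists_father (x : V) : ∃ y, T.graph.Adj x y ∧ T.level y = T.level x + 1 := by
  let k := T.projIndex x + 1
  have hne : T.ray k ≠ x := by
    intro h
    have h1 := T.projIndex_ray k
    rw [h] at h1
    omega
  obtain ⟨y, hy, h⟩ := T.isTree.exists_adj_dist_lt hne
  refine ⟨y, hy, ?_⟩
  rcases T.level_adj hy with h1 | h1
  · exfalso
    have h2 := T.level_eq (x := x) (k := max k (T.projIndex y)) (by omega)
    have h3 := T.level_eq (x := y) (k := max k (T.projIndex y)) (by omega)
    have h4 := T.level_eq (x := x) (k := k) (by omega)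
    have h5 : T.graph.dist y (T.ray (max k (T.projIndex y))) ≤
        T.graph.dist y (T.ray k) + T.graph.dist (T.ray k) (T.ray (max k (T.projIndex y))) :=
      T.isTree.connected.dist_triangle
    have h6 := T.ray_geodesic k (max k (T.projIndex y) - k)
    rw [Nat.add_sub_cancel' (le_max_left _ _)] at h6
    rw [SimpleGraph.dist_comm, SimpleGraph.dist_comm (v := y)] at h
    omega
  · exact h1

/-- The neighbour of `x` one level above it. -/
noncomputable def father (x : V) : V := (T.exists_father x).choose

theorem adj_father (x : V) : T.graph.Adj x (T.father x) := (T.exists_father x).choose_spec.1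

theorem level_father (x : V) : T.level (T.father x) = T.level x + 1 :=
  (T.exists_father x).choose_spec.2

/-- Seen from a far enough ray point, every neighbour one level up is a neighbour closer to that
point, and there is only one of these. -/
theorem eq_father {x y : V} (h : T.graph.Adj x y) (hl : T.level y = T.level x + 1) :
    T.father x = y := by
  let k := max (T.projIndex x) (max (T.projIndex y) (T.projIndex (T.father x)))
  have h1 := T.level_eq (x := x) (k := k) (by omega)
  have h2 := T.level_eq (x := y) (k := k) (by omega)
  have h3 := T.level_eq (x := T.father x) (k := k) (by omega)
  rw [SimpleGraph.dist_comm] at h1 h2 h3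
  have h4 := T.level_father x
  exact T.isTree.eq_of_adj_of_dist_lt (u := T.ray k) (T.adj_father x).symm h.symm
    (by omega) (by omega)

theorem father_ray (k : ℕ) : T.father (T.ray k) = T.ray (k + 1) :=
  T.eq_father (T.adj_ray k) (by simp [T.level_ray])

theorem iterate_father_ray (k : ℕ) : T.father^[k] (T.ray 0) = T.ray k := by
  induction k with
  | zero => rfl
  | succ k ih => rw [Function.iterate_succ_apply', ih, father_ray]

theorem father_eq_or {x y : V} (h : T.graph.Adj x y) : T.father x = y ∨ T.father y = x := by
  rcases T.level_adj h with h1 | h1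
  · exact .inr (T.eq_father h.symm h1)
  · exact .inl (T.eq_father h h1)

theorem mem_sons {x y : V} : y ∈ T.sons x ↔ T.father y = x := by
  constructor
  · rintro ⟨h, hl⟩
    exact T.eq_father h (by omega)
  · rintro rfl
    exact ⟨T.adj_father y, by rw [T.level_father]; ring⟩

theorem level_iterate (n : ℕ) (x : V) : T.level (T.father^[n] x) = T.level x + n := by
  induction n with
  | zero => simp
  | succ n ih => rw [Function.iterate_succ_apply', T.level_father, ih]; push_cast; ring

theorem abs_level_sub_le (x y : V) : |T.level x - T.level y| ≤ T.graph.dist x y := by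
  obtain ⟨p, hp⟩ := T.isTree.connected.exists_walk_length_eq_dist x y
  rw [← hp]
  clear hp
  induction p with
  | nil => simp
  | cons h p ih =>
    rw [SimpleGraph.Walk.length_cons]
    rw [abs_le] at *
    rcases T.level_adj h with h1 | h1 <;> push_cast <;> constructor <;> omega

theorem dist_iterate (n : ℕ) (x : V) : T.graph.dist x (T.father^[n] x) = n := by
  apply le_antisymm
  · induction n with
    | zero => simp
    | succ n ih =>
      have h : T.graph.dist x (T.father^[n + 1] x) ≤ T.graph.dist x (T.father^[n] x) +
        T.graph.dist (T.father^[n] x) (T.father^[n + 1] x) := T.isTree.connected.dist_triangle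
      rw [Function.iterate_succ_apply'] at *
      rw [SimpleGraph.dist_eq_one_iff_adj.2 (T.adj_father _)] at h
      omega
  · have h := T.abs_level_sub_le x (T.father^[n] x)
    rw [T.level_iterate, abs_le] at h
    omega

theorem below_iff {x y : V} : T.Below y x ↔ ∃ n, T.father^[n] y = x := by
  constructor
  -- Each edge of a geodesic from `y` to `x` changes the level by one, and the total change equals
  -- the length; hence every edge goes up.
  · intro h
    unfold Below at h
    obtain ⟨p, hp⟩ := T.isTree.connected.exists_walk_length_eq_dist y x
    rw [SimpleGraph.dist_comm, ← hp] at h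
    refine ⟨p.length, ?_⟩
    clear hp
    induction p with
    | nil => rfl
    | @cons u v w hadj q ih =>
      rw [SimpleGraph.Walk.length_cons] at h ⊢
      have h1 := T.abs_level_sub_le v w
      have h2 : T.graph.dist v w ≤ q.length := SimpleGraph.dist_le q
      rw [abs_le] at h1
      rcases T.level_adj hadj with h3 | h3
      · push_cast at h; omega
      · rw [Function.iterate_succ_apply, T.eq_father hadj h3]
        exact ih (by push_cast at h; omega)
  · rintro ⟨n, rfl⟩
    rw [Below, T.level_iterate, SimpleGraph.dist_comm, T.dist_iterate]
    ring

/-! ### Generations and trapezoids. -/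

/-- The vertices that lie `n` generations below `x`. -/
def descendants (x : V) (n : ℕ) : Set V := {y | T.father^[n] y = x}

theorem mem_trapezoid {x y : V} {a b : ℕ} :
    y ∈ T.trapezoid x a b ↔ ∃ n, a ≤ n ∧ n < b ∧ y ∈ T.descendants x n := by
  simp only [trapezoid, mem_ofPred_eq, T.below_iff, descendants]
  constructor
  · rintro ⟨⟨n, rfl⟩, h1, h2⟩
    rw [T.level_iterate] at h1 h2
    exact ⟨n, by omega, by omega, rfl⟩
  · rintro ⟨n, h1, h2, rfl⟩
    rw [T.level_iterate]
    exact ⟨⟨n, rfl⟩, by omega, by omega⟩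

theorem descendants_zero (x : V) : T.descendants x 0 = {x} := by
  ext y; simp [descendants]

theorem descendants_succ (x : V) (n : ℕ) :
    T.descendants x (n + 1) = ⋃ y ∈ T.sons x, T.descendants y n := by
  ext z
  simp only [descendants, mem_ofPred_eq, mem_iUnion, T.mem_sons, exists_prop,
    Function.iterate_succ_apply']
  exact ⟨fun h => ⟨_, h, rfl⟩, fun ⟨y, h, hz⟩ => hz ▸ h⟩

theorem level_of_mem_descendants {x y : V} {n : ℕ} (h : y ∈ T.descendants x n) :
    T.level x = T.level y + n := by
  rw [← (h : _ = x), T.level_iterate]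

/-- A walk leaves the proper descendants of `x` only through `x`, and climbing from `z` to `x` takes
`n` steps. A shorter walk stays strictly below `x`, and each step shifts the generation by one. -/
theorem exists_mem_descendants_of_dist {x z : V} {n : ℕ} (hz : z ∈ T.descendants x n) {y : V}
    (h : T.graph.dist y z < n) : ∃ k, 0 < k ∧ k ≤ n + T.graph.dist y z ∧ y ∈ T.descendants x k := by
  obtain ⟨p, hp⟩ := T.isTree.connected.exists_walk_length_eq_dist y z
  rw [← hp] at h ⊢
  clear hp
  induction p with
  | nil => exact ⟨n, by omega, by simp, hz⟩
  | @cons u v w hadj q ih =>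
    rw [SimpleGraph.Walk.length_cons] at h ⊢
    obtain ⟨k, hk, hk', hv⟩ := ih hz (by omega)
    rcases T.father_eq_or hadj with hf | hf
    · refine ⟨k + 1, by omega, by omega, ?_⟩
      rw [descendants, mem_ofPred_eq, Function.iterate_succ_apply, hf]
      exact hv
    · have hlv := T.level_of_mem_descendants hv
      by_cases hk1 : k = 1
      · exfalso
        have h1 := T.abs_level_sub_le v w
        have h2 : T.graph.dist v w ≤ q.length := SimpleGraph.dist_le q
        have h3 := T.level_of_mem_descendants hz
        rw [abs_le] at h1
        omega
      · obtain ⟨j, rfl⟩ : ∃ j, k = j + 1 := ⟨k - 1, by omega⟩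
        refine ⟨j, by omega, by omega, ?_⟩
        rw [descendants, mem_ofPred_eq, Function.iterate_succ_apply, hf] at hv
        exact hv

theorem enlargement_subset (x : V) (a b : ℕ) :
    T.enlargement x a b ⊆ ⋃ n ∈ Finset.range (a + b), T.descendants x n := by
  rintro y ⟨z, hz, hd⟩
  obtain ⟨n, h1, h2, hn⟩ := T.mem_trapezoid.1 hz
  obtain ⟨k, -, hk, h⟩ := T.exists_mem_descendants_of_dist hn (hd.trans_le h1)
  simp only [mem_iUnion, Finset.mem_range, exists_prop]
  exact ⟨k, by omega, h⟩

theorem trapezoid_eq_iUnion (x : V) (a b : ℕ) :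
    T.trapezoid x a b = ⋃ n ∈ Finset.Ico a b, T.descendants x n := by
  ext y
  simp [T.mem_trapezoid, and_assoc]

theorem disjoint_descendants_level (x : V) {n k : ℕ} (h : n ≠ k) :
    Disjoint (T.descendants x n) (T.descendants x k) := by
  rw [Set.disjoint_left]
  intro y h1 h2
  have := T.level_of_mem_descendants h1
  have := T.level_of_mem_descendants h2
  omega

theorem disjoint_descendants {x y : V} (n : ℕ) (h : x ≠ y) :
    Disjoint (T.descendants x n) (T.descendants y n) := by
  rw [Set.disjoint_left]
  intro z h1 h2
  exact h (h1.symm.trans h2)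

theorem trapezoid_split (x : V) {a b c : ℕ} (hab : a ≤ b) (hbc : b ≤ c) :
    T.trapezoid x a c = T.trapezoid x a b ∪ T.trapezoid x b c := by
  ext y
  simp only [mem_union, T.mem_trapezoid]
  constructor
  · rintro ⟨n, h1, h2, h⟩
    rcases lt_or_ge n b with h3 | h3
    · exact .inl ⟨n, h1, h3, h⟩
    · exact .inr ⟨n, h3, h2, h⟩
  · rintro (⟨n, h1, h2, h⟩ | ⟨n, h1, h2, h⟩)
    · exact ⟨n, h1, by omega, h⟩
    · exact ⟨n, by omega, h2, h⟩

theorem disjoint_trapezoid_level (x : V) (a b c : ℕ) :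
    Disjoint (T.trapezoid x a b) (T.trapezoid x b c) := by
  rw [Set.disjoint_left]
  intro y h1 h2
  obtain ⟨n, h1, h3, h4⟩ := T.mem_trapezoid.1 h1
  obtain ⟨k, h5, h6, h7⟩ := T.mem_trapezoid.1 h2
  have := T.level_of_mem_descendants h4
  have := T.level_of_mem_descendants h7
  omega

/-- One of the two cuts of the stopping-time argument: passing to the sons lowers both parameters by
one. -/
theorem trapezoid_succ (x : V) (a b : ℕ) :
    T.trapezoid x (a + 1) (b + 1) = ⋃ y ∈ T.sons x, T.trapezoid y a b := by
  ext z
  simp only [mem_iUnion, exists_prop, T.mem_trapezoid]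
  constructor
  · rintro ⟨n, h1, h2, h⟩
    obtain ⟨n, rfl⟩ : ∃ k, n = k + 1 := ⟨n - 1, by omega⟩
    rw [T.descendants_succ] at h
    simp only [mem_iUnion, exists_prop] at h
    obtain ⟨y, hy, h⟩ := h
    exact ⟨y, hy, n, by omega, by omega, h⟩
  · rintro ⟨y, hy, n, h1, h2, h⟩
    refine ⟨n + 1, by omega, by omega, ?_⟩
    rw [T.descendants_succ]
    exact mem_biUnion hy h

theorem disjoint_trapezoid_sons {x y y' : V} (hy : y ∈ T.sons x) (hy' : y' ∈ T.sons x)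
    (h : y ≠ y') (a b : ℕ) : Disjoint (T.trapezoid y a b) (T.trapezoid y' a b) := by
  rw [Set.disjoint_left]
  intro z h1 h2
  obtain ⟨n, -, -, h3⟩ := T.mem_trapezoid.1 h1
  obtain ⟨k, -, -, h4⟩ := T.mem_trapezoid.1 h2
  have h5 := T.level_of_mem_descendants h3
  have h6 := T.level_of_mem_descendants h4
  have h7 := hy.2
  have h8 := hy'.2
  obtain rfl : n = k := by omega
  exact Set.disjoint_left.1 (T.disjoint_descendants n h) h3 h4

/-- These trapezoids occupy levels from above `-10k` up to `k`, so they eventually contain any given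
vertex, and hence any finite set. -/
theorem exists_mem_trapezoid_ray (x : V) :
    ∃ n : ℕ, ∀ k ≥ n, x ∈ T.trapezoid (T.ray (2 * k)) k (12 * k) := by
  refine ⟨T.projIndex x + (T.level x).natAbs + 1, fun k hk => ?_⟩
  have h := T.level_eq (x := x) (k := 2 * k) (by omega)
  have hd : T.graph.dist (T.ray (2 * k)) x = T.graph.dist x (T.ray (2 * k)) :=
    SimpleGraph.dist_comm
  refine ⟨?_, ?_, ?_⟩ <;> simp only [Below, T.level_ray] <;> omega

end TreeAtInfinity

/-! ### The flow measure: local finiteness and masses of trapezoids. -/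

section vertexMeasure

variable {V : Type*} [MeasurableSpace V] [DiscreteMeasurableSpace V]

theorem vertexMeasure_singleton (m : V → ℝ) (x : V) :
    vertexMeasure m {x} = ENNReal.ofReal (m x) := by
  rw [vertexMeasure, Measure.sum_apply _ (MeasurableSet.of_discrete), tsum_eq_single x]
  · simp
  · intro y hy
    simp [hy]

end vertexMeasure

namespace TreeAtInfinity

variable {V : Type*} {T : TreeAtInfinity V} {m : V → ℝ}

theorem IsFlow.exists_son (hm : T.IsFlow m) (x : V) : ∃ y, T.father y = x := by
  by_contra! h
  have : IsEmpty (T.sons x) := ⟨fun y => h y (T.mem_sons.1 y.2)⟩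
  exact (hm.1 x).ne' (hm.2 x |>.unique hasSum_empty)

theorem IsFlow.le_father (hm : T.IsFlow m) (x : V) : m x ≤ m (T.father x) :=
  le_hasSum (hm.2 (T.father x)) ⟨x, T.mem_sons.2 rfl⟩ fun y _ => (hm.1 y).le

theorem IsFlow.le_iterate (hm : T.IsFlow m) (n : ℕ) (x : V) : m x ≤ m (T.father^[n] x) := by
  induction n with
  | zero => simp
  | succ n ih => rw [Function.iterate_succ_apply']; exact ih.trans (hm.le_father _)

variable [MeasurableSpace V] [DiscreteMeasurableSpace V]

/-- Doubling is used at a son `y` of `x`. The ball of radius 2 contains the father of `x`; the ball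
of radius 1 consists of `y`, its sons and `x`, so its mass is at most `m y + m y + m x ≤ 3 * m x`.
-/
theorem IsFlow.exists_father_le (hm : T.IsFlow m) (hd : T.IsLocallyDoubling m) :
    ∃ C : ℝ≥0, 0 < C ∧ ∀ x, m (T.father x) ≤ C * m x := by
  obtain ⟨C, hC, h⟩ := hd 1 one_pos
  refine ⟨3 * C, by positivity, fun x => ?_⟩
  obtain ⟨y, rfl⟩ := hm.exists_son x
  have h1 : ENNReal.ofReal (m (T.father (T.father y))) ≤ vertexMeasure m (T.ball y (2 * 1)) := by
    rw [← vertexMeasure_singleton]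
    refine measure_mono (singleton_subset_iff.2 ?_)
    change T.graph.dist _ _ ≤ _
    rw [SimpleGraph.dist_comm]
    exact (T.dist_iterate 2 y).le
  have h2 : T.ball y 1 ⊆ {y} ∪ (⋃ z : T.sons y, {z.1}) ∪ {T.father y} := by
    intro z hz
    have hz : T.graph.dist z y ≤ 1 := hz
    rcases Nat.le_one_iff_eq_zero_or_eq_one.1 hz with h0 | h0
    · exact .inl (.inl (T.isTree.connected.dist_eq_zero_iff.1 h0))
    · rcases T.father_eq_or (SimpleGraph.dist_eq_one_iff_adj.1 h0) with h3 | h3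
      · exact .inl (.inr (mem_iUnion.2 ⟨⟨z, T.mem_sons.2 h3⟩, rfl⟩))
      · exact .inr h3.symm
  have hc : Countable (T.sons y) := by
    have := (hm.2 y).summable.countable_support
    rwa [show Function.support (fun z : T.sons y => m z) = univ from
      eq_univ_of_forall fun z => (hm.1 z).ne', countable_univ_iff] at this
  have h3 : vertexMeasure m (⋃ z : T.sons y, {z.1}) ≤ ENNReal.ofReal (m y) := by
    refine (measure_iUnion_le _).trans ?_
    simp only [vertexMeasure_singleton]
    rw [← ENNReal.ofReal_tsum_of_nonneg (fun z => (hm.1 _).le) (hm.2 y).summable,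
      (hm.2 y).tsum_eq]
  have h4 : vertexMeasure m (T.ball y 1) ≤ ENNReal.ofReal (3 * m (T.father y)) := by
    refine (measure_mono h2).trans ((measure_union_le _ _).trans
      ((add_le_add (measure_union_le _ _) le_rfl).trans ?_))
    rw [vertexMeasure_singleton, vertexMeasure_singleton]
    refine (add_le_add (add_le_add le_rfl h3) le_rfl).trans ?_
    have := hm.1 y
    have := hm.1 (T.father y)
    rw [← ENNReal.ofReal_add (by positivity) (by positivity),
      ← ENNReal.ofReal_add (by positivity) (by positivity)]
    refine ENNReal.ofReal_le_ofReal ?_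
    linarith [hm.le_father y]
  have h5 := h1.trans ((h y).trans (mul_le_mul_right h4 _))
  rw [← ENNReal.ofReal_coe_nnreal, ← ENNReal.ofReal_mul (NNReal.coe_nonneg C),
    ENNReal.ofReal_le_ofReal_iff] at h5
  · push_cast
    linarith
  · have := hm.1 (T.father y)
    positivity

/-- The masses of the sons are summable and bounded below by `m x / C`. -/
theorem IsFlow.finite_sons (hm : T.IsFlow m) (hd : T.IsLocallyDoubling m) (x : V) :
    (T.sons x).Finite := by
  obtain ⟨C, hC, h⟩ := hm.exists_father_le hd
  have hpos : 0 < m x / C := div_pos (hm.1 x) (by exact_mod_cast hC)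
  have h1 := (hm.2 x).summable.tendsto_cofinite_zero.eventually_lt_const hpos
  rw [Filter.eventually_cofinite] at h1
  rw [show {y : T.sons x | ¬ m y < m x / C} = univ from eq_univ_of_forall fun y => ?_] at h1
  · exact finite_univ_iff.1 h1
  · have h2 := h y
    rw [T.mem_sons.1 y.2] at h2
    simp only [mem_ofPred_eq, not_lt]
    rw [div_le_iff₀' (by exact_mod_cast hC)]
    exact h2

theorem IsFlow.finite_descendants (hm : T.IsFlow m) (hd : T.IsLocallyDoubling m) (x : V) (n : ℕ) :
    (T.descendants x n).Finite := by
  induction n generalizing x with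
  | zero => simp [T.descendants_zero]
  | succ n ih => rw [T.descendants_succ]; exact (hm.finite_sons hd x).biUnion fun y _ => ih y

theorem IsFlow.finite_trapezoid (hm : T.IsFlow m) (hd : T.IsLocallyDoubling m) (x : V) (a b : ℕ) :
    (T.trapezoid x a b).Finite := by
  rw [T.trapezoid_eq_iUnion]
  exact (Finset.finite_toSet _).biUnion fun n _ => hm.finite_descendants hd x n

theorem IsFlow.countable (hm : T.IsFlow m) (hd : T.IsLocallyDoubling m) : Countable V := by
  rw [← countable_univ_iff]
  refine (countable_iUnion fun k : ℕ =>
    (hm.finite_trapezoid hd (T.ray (2 * k)) k (12 * k)).countable).mono fun x _ => ?_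
  obtain ⟨n, hn⟩ := T.exists_mem_trapezoid_ray x
  exact mem_iUnion.2 ⟨n, hn n le_rfl⟩

theorem IsFlow.measure_descendants (hm : T.IsFlow m) (hd : T.IsLocallyDoubling m) (x : V) (n : ℕ) :
    vertexMeasure m (T.descendants x n) = ENNReal.ofReal (m x) := by
  induction n generalizing x with
  | zero => rw [T.descendants_zero, vertexMeasure_singleton]
  | succ n ih =>
    rw [T.descendants_succ, measure_biUnion (hm.finite_sons hd x).countable
      (fun y _ z _ h => T.disjoint_descendants n h) fun _ _ => MeasurableSet.of_discrete]
    simp only [ih]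
    rw [← ENNReal.ofReal_tsum_of_nonneg (fun z => (hm.1 _).le) (hm.2 x).summable,
      (hm.2 x).tsum_eq]

theorem IsFlow.measure_trapezoid (hm : T.IsFlow m) (hd : T.IsLocallyDoubling m) (x : V)
    (a b : ℕ) : vertexMeasure m (T.trapezoid x a b) = (b - a : ℕ) * ENNReal.ofReal (m x) := by
  rw [T.trapezoid_eq_iUnion, measure_biUnion_finset
    (fun n _ k _ h => T.disjoint_descendants_level x h) fun _ _ => MeasurableSet.of_discrete]
  simp [hm.measure_descendants hd]

/-- The enlargement lies in the `a + b` generations from `x` on, and `a + b ≤ 3 * (b - a)` when `2 *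
a ≤ b`. -/
theorem IsFlow.measure_enlargement_le (hm : T.IsFlow m) (hd : T.IsLocallyDoubling m) (x : V)
    {a b : ℕ} (h : 2 * a ≤ b) : vertexMeasure m (T.enlargement x a b) ≤
      3 * vertexMeasure m (T.trapezoid x a b) := by
  refine (measure_mono (T.enlargement_subset x a b)).trans
    ((measure_biUnion_finset_le _ _).trans ?_)
  simp only [hm.measure_descendants hd, hm.measure_trapezoid hd, Finset.sum_const,
    Finset.card_range, nsmul_eq_mul]
  rw [← mul_assoc]
  gcongr
  norm_cast
  omega

theorem IsFlow.trapezoid_nonempty (hm : T.IsFlow m) (hd : T.IsLocallyDoubling m) (x : V)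
    {a b : ℕ} (h : a < b) : (T.trapezoid x a b).Nonempty := by
  refine nonempty_of_measure_ne_zero (μ := vertexMeasure m) ?_
  rw [hm.measure_trapezoid hd]
  refine mul_ne_zero (by exact_mod_cast (by omega : b - a ≠ 0)) ?_
  simpa using hm.1 x

theorem IsFlow.measure_singleton_ne_zero (hm : T.IsFlow m) (x : V) :
    vertexMeasure m {x} ≠ 0 := by
  rw [vertexMeasure_singleton]
  simpa using hm.1 x

end TreeAtInfinity

theorem vertexMeasure_singleton_ne_top {V : Type*} [MeasurableSpace V] [DiscreteMeasurableSpace V]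
    (m : V → ℝ) (x : V) : vertexMeasure m {x} ≠ ∞ := by
  rw [vertexMeasure_singleton]
  exact ENNReal.ofReal_ne_top

theorem admissibleParams_iff {β : ℝ} {a b : ℕ} :
    AdmissibleParams β a b ↔ 0 < a ∧ 2 * a ≤ b ∧ (b : ℝ) ≤ β * a := by
  constructor
  · rintro ⟨h1, h2, h3, h4⟩
    have ha : (0 : ℝ) < a := by exact_mod_cast h1
    rw [le_div_iff₀ ha] at h3
    rw [div_le_iff₀ ha] at h4
    exact ⟨h1, by exact_mod_cast h3, h4⟩
  · rintro ⟨h1, h2, h3⟩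
    have ha : (0 : ℝ) < a := by exact_mod_cast h1
    refine ⟨h1, by omega, ?_, ?_⟩
    · rw [le_div_iff₀ ha]; exact_mod_cast h2
    · rwa [div_le_iff₀ ha]

/-! ### Calderón–Zygmund decompositions and what they imply. -/

section kernelOp

variable {V : Type*} [MeasurableSpace V]

/-- The integral operator with kernel `K`. -/
noncomputable def kernelOp (μ : Measure V) (K : V → V → ℂ) (f : V → ℂ) (x : V) : ℂ :=
  ∫ y, K x y * f y ∂μ

variable {μ : Measure V} {K : V → V → ℂ}

/-- A Calderón–Zygmund decomposition of `f` at height `α` on `R`: a good part `g` bounded by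
`M`, and a bad part `h` whose image under the operator with kernel `K` is integrable off a small
exceptional set `E`. -/
def HasCZDecomposition (μ : Measure V) (K : V → V → ℂ) (α M H : ℝ≥0∞) (R : Set V)
    (f : V → ℂ) : Prop :=
  ∃ (g h : V → ℂ) (E : Set V), f = g + h ∧ Function.support g ⊆ R ∧ Function.support h ⊆ R ∧
    (∀ x, ‖g x‖ₑ ≤ M) ∧ ∫⁻ x, ‖g x‖ₑ ∂μ ≤ ∫⁻ x, ‖f x‖ₑ ∂μ ∧
    α * μ E ≤ 3 * ∫⁻ x, ‖f x‖ₑ ∂μ ∧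
    ∫⁻ x in Eᶜ, ‖kernelOp μ K h x‖ₑ ∂μ ≤ 2 * H * ∫⁻ x, ‖f x‖ₑ ∂μ

theorem hasCZDecomposition_of_bounded {α M H : ℝ≥0∞} {R : Set V} {f : V → ℂ}
    (hf : Function.support f ⊆ R) (hM : ∀ x, ‖f x‖ₑ ≤ M) : HasCZDecomposition μ K α M H R f :=
  ⟨f, 0, ∅, by simp, hf, by simp, hM, le_rfl, by simp, by simp [kernelOp]⟩

variable [DiscreteMeasurableSpace V]

theorem lintegral_indicator_enorm (R : Set V) (f : V → ℂ) :
    ∫⁻ x, ‖R.indicator f x‖ₑ ∂μ = ∫⁻ x in R, ‖f x‖ₑ ∂μ := by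
  rw [← lintegral_indicator MeasurableSet.of_discrete]
  simp only [enorm_indicator_eq_indicator_enorm]

theorem lintegral_enorm_eq_setLIntegral {f : V → ℂ} {R : Set V} (h : Function.support f ⊆ R) :
    ∫⁻ x, ‖f x‖ₑ ∂μ = ∫⁻ x in R, ‖f x‖ₑ ∂μ := by
  rw [← lintegral_indicator_enorm, indicator_eq_self.2 h]

theorem integrable_of_finite_support (hμ : ∀ x, μ {x} ≠ ∞) {f : V → ℂ}
    (hf : (Function.support f).Finite) : Integrable f μ := by
  rw [← integrableOn_iff_integrable_of_support_subset (s := Function.support f) subset_rfl]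
  rw [← biUnion_of_singleton (Function.support f), integrableOn_finite_biUnion hf]
  intro x _
  exact integrableOn_singleton (hx := (hμ x).lt_top)

theorem kernelOp_add (hμ : ∀ x, μ {x} ≠ ∞) {f g : V → ℂ}
    (hf : (Function.support f).Finite) (hg : (Function.support g).Finite) (x : V) :
    kernelOp μ K (f + g) x = kernelOp μ K f x + kernelOp μ K g x := by
  simp only [kernelOp, Pi.add_apply, mul_add]
  refine integral_add (integrable_of_finite_support hμ (hf.subset ?_))
    (integrable_of_finite_support hμ (hg.subset ?_)) <;>
  exact fun y hy => right_ne_zero_of_mul hy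

theorem lintegral_enorm_add_of_disjoint {f₁ f₂ : V → ℂ} {R₁ R₂ : Set V}
    (h₁ : Function.support f₁ ⊆ R₁) (h₂ : Function.support f₂ ⊆ R₂) (hd : Disjoint R₁ R₂) :
    ∫⁻ x, ‖(f₁ + f₂) x‖ₑ ∂μ = ∫⁻ x, ‖f₁ x‖ₑ ∂μ + ∫⁻ x, ‖f₂ x‖ₑ ∂μ := by
  rw [← lintegral_add_left Measurable.of_discrete]
  refine lintegral_congr fun x => ?_
  by_cases hx : f₁ x = 0
  · simp [hx]
  · have : f₂ x = 0 := by
      by_contra h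
      exact Set.disjoint_left.1 hd (h₁ hx) (h₂ h)
    simp [this]

/-- All integral bounds are additive in `∫ |f|`. Disjointness of the supports is what keeps the
uniform bound `M` on the good part from doubling. -/
theorem HasCZDecomposition.add (hμ : ∀ x, μ {x} ≠ ∞) {α M H : ℝ≥0∞} {R₁ R₂ : Set V}
    (hR₁ : R₁.Finite) (hR₂ : R₂.Finite) (hd : Disjoint R₁ R₂) {f₁ f₂ : V → ℂ}
    (hf₁ : Function.support f₁ ⊆ R₁) (hf₂ : Function.support f₂ ⊆ R₂)
    (h₁ : HasCZDecomposition μ K α M H R₁ f₁) (h₂ : HasCZDecomposition μ K α M H R₂ f₂) :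
    HasCZDecomposition μ K α M H (R₁ ∪ R₂) (f₁ + f₂) := by
  obtain ⟨g₁, b₁, E₁, hf1, hg1, hb1, hM1, hgf1, hE1, hH1⟩ := h₁
  obtain ⟨g₂, b₂, E₂, hf2, hg2, hb2, hM2, hgf2, hE2, hH2⟩ := h₂
  have hff := lintegral_enorm_add_of_disjoint (μ := μ) hf₁ hf₂ hd
  refine ⟨g₁ + g₂, b₁ + b₂, E₁ ∪ E₂, ?_, ?_, ?_, fun x => ?_, ?_, ?_, ?_⟩
  · rw [hf1, hf2]; abel
  · exact (Function.support_add g₁ g₂).trans (union_subset_union hg1 hg2)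
  · exact (Function.support_add b₁ b₂).trans (union_subset_union hb1 hb2)
  · by_cases hx : g₁ x = 0
    · simpa [hx] using hM2 x
    · have : g₂ x = 0 := by
        by_contra h
        exact Set.disjoint_left.1 hd (hg1 hx) (hg2 h)
      simpa [this] using hM1 x
  · rw [hff, lintegral_enorm_add_of_disjoint hg1 hg2 hd]
    exact add_le_add hgf1 hgf2
  · rw [hff, mul_add]
    refine le_trans ?_ (add_le_add hE1 hE2)
    rw [← mul_add]
    gcongr
    exact measure_union_le _ _
  · rw [hff, mul_add]
    refine le_trans ?_ (add_le_add hH1 hH2)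
    calc ∫⁻ x in (E₁ ∪ E₂)ᶜ, ‖kernelOp μ K (b₁ + b₂) x‖ₑ ∂μ
        ≤ ∫⁻ x in (E₁ ∪ E₂)ᶜ, (‖kernelOp μ K b₁ x‖ₑ + ‖kernelOp μ K b₂ x‖ₑ) ∂μ := by
          refine lintegral_mono fun x => ?_
          rw [kernelOp_add hμ (hR₁.subset hb1) (hR₂.subset hb2)]
          exact enorm_add_le _ _
      _ = ∫⁻ x in (E₁ ∪ E₂)ᶜ, ‖kernelOp μ K b₁ x‖ₑ ∂μ +
            ∫⁻ x in (E₁ ∪ E₂)ᶜ, ‖kernelOp μ K b₂ x‖ₑ ∂μ :=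
          lintegral_add_left Measurable.of_discrete _
      _ ≤ _ := by
          gcongr
          · exact subset_union_left
          · exact subset_union_right

theorem hasCZDecomposition_iUnion (hμ : ∀ x, μ {x} ≠ ∞) {α M H L : ℝ≥0∞} {ι : Type*}
    (s : Finset ι) {R : ι → Set V} (hR : ∀ i ∈ s, (R i).Finite)
    (hd : (s : Set ι).PairwiseDisjoint R)
    (h : ∀ i ∈ s, ∀ f : V → ℂ, Function.support f ⊆ R i → ∫⁻ x, ‖f x‖ₑ ∂μ ≤ L →
      HasCZDecomposition μ K α M H (R i) f)
    {f : V → ℂ} (hf : Function.support f ⊆ ⋃ i ∈ s, R i) (hL : ∫⁻ x, ‖f x‖ₑ ∂μ ≤ L) :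
    HasCZDecomposition μ K α M H (⋃ i ∈ s, R i) f := by
  classical
  induction s using Finset.induction_on generalizing f with
  | empty =>
    refine hasCZDecomposition_of_bounded hf fun x => ?_
    have : f x = 0 := by
      by_contra hx
      simpa using hf hx
    simp [this]
  | insert i s his ih =>
    rw [Finset.set_biUnion_insert] at hf ⊢
    have hdis : Disjoint (R i) (⋃ j ∈ s, R j) := by
      rw [disjoint_iUnion₂_right]
      intro j hj
      exact hd (by simp) (by simp [hj]) fun hij => his (hij ▸ hj)
    have hsum : f = (R i).indicator f + (⋃ j ∈ s, R j).indicator f := by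
      have h := indicator_union_of_disjoint hdis f
      rwa [indicator_eq_self.2 hf] at h
    have hle : ∀ S : Set V, ∫⁻ x, ‖S.indicator f x‖ₑ ∂μ ≤ L := fun S => by
      rw [lintegral_indicator_enorm]
      exact (setLIntegral_le_lintegral _ _).trans hL
    rw [hsum]
    refine HasCZDecomposition.add hμ (hR i (by simp))
      ((Finset.finite_toSet s).biUnion fun j hj => hR j (Finset.mem_insert_of_mem hj)) hdis
      support_indicator_subset support_indicator_subset
      (h i (by simp) _ support_indicator_subset (hle _))
      (ih (fun j hj => hR j (by simp [hj])) (hd.subset (by simp))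
        (fun j hj => h j (by simp [hj])) support_indicator_subset (hle _))

/-- Since `h` has mean zero, `K x y` may be replaced by `K x y - K x z` for a fixed `z` in `R`; then
Tonelli applies. -/
theorem lintegral_kernelOp_le [Countable V] [SFinite μ] (hμ : ∀ x, μ {x} ≠ ∞) {H : ℝ≥0∞}
    {E : Set V} {R : Set V} (hR : R.Finite)
    (hH : ∀ y ∈ R, ∀ z ∈ R, ∫⁻ x in Eᶜ, ‖K x y - K x z‖ₑ ∂μ ≤ H) {h : V → ℂ}
    (hh : Function.support h ⊆ R) (h0 : ∫ x, h x ∂μ = 0) :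
    ∫⁻ x in Eᶜ, ‖kernelOp μ K h x‖ₑ ∂μ ≤ H * ∫⁻ x, ‖h x‖ₑ ∂μ := by
  rcases R.eq_empty_or_nonempty with rfl | ⟨z, hz⟩
  · have : h = 0 := Function.support_eq_empty_iff.1 (subset_empty_iff.1 hh)
    simp [this, kernelOp]
  have hker : ∀ x, kernelOp μ K h x = ∫ y, (K x y - K x z) * h y ∂μ := by
    intro x
    simp only [sub_mul]
    rw [integral_sub, integral_const_mul, h0, mul_zero, sub_zero, kernelOp] <;>
    · refine integrable_of_finite_support hμ ((hR.subset hh).subset ?_)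
      exact fun y hy => right_ne_zero_of_mul hy
  calc ∫⁻ x in Eᶜ, ‖kernelOp μ K h x‖ₑ ∂μ
      ≤ ∫⁻ x in Eᶜ, ∫⁻ y, ‖K x y - K x z‖ₑ * ‖h y‖ₑ ∂μ ∂μ := by
        refine lintegral_mono fun x => ?_
        rw [hker]
        refine (enorm_integral_le_lintegral_enorm _).trans_eq ?_
        simp only [enorm_mul]
    _ = ∫⁻ y, ∫⁻ x in Eᶜ, ‖K x y - K x z‖ₑ * ‖h y‖ₑ ∂μ ∂μ :=
        lintegral_lintegral_swap Measurable.of_discrete.aemeasurable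
    _ ≤ ∫⁻ y, H * ‖h y‖ₑ ∂μ := by
        refine lintegral_mono fun y => ?_
        by_cases hy : h y = 0
        · simp [hy]
        · rw [lintegral_mul_const _ Measurable.of_discrete]
          gcongr
          exact hH y (hh hy) z hz
    _ = H * ∫⁻ x, ‖h x‖ₑ ∂μ := lintegral_const_mul _ Measurable.of_discrete

/-- The stopping case. The good part is the mean of `f` on `R`; the bad part `f` minus the mean has
integral zero and `L¹` norm at most twice that of `f`, which is the source of the factor 2. -/
theorem hasCZDecomposition_of_average [Countable V] [SFinite μ] (hμ : ∀ x, μ {x} ≠ ∞)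
    {α M H : ℝ≥0∞} {E R : Set V} (hR : R.Finite) (hR0 : μ R ≠ 0)
    (hH : ∀ y ∈ R, ∀ z ∈ R, ∫⁻ x in Eᶜ, ‖K x y - K x z‖ₑ ∂μ ≤ H) (hE : μ E ≤ 3 * μ R)
    {f : V → ℂ} (hf : Function.support f ⊆ R) (hα : α * μ R ≤ ∫⁻ x, ‖f x‖ₑ ∂μ)
    (hM : ∫⁻ x, ‖f x‖ₑ ∂μ ≤ M * μ R) : HasCZDecomposition μ K α M H R f := by
  have hRt : μ R ≠ ∞ := by
    rw [← biUnion_of_singleton R]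
    exact ((measure_biUnion_lt_top hR fun x _ => (hμ x).lt_top)).ne
  have hfi : Integrable f μ := integrable_of_finite_support hμ (hR.subset hf)
  set c : ℂ := ((μ R).toReal⁻¹ : ℝ) * ∫ x, f x ∂μ with hc
  have hcn : ‖c‖ₑ * μ R ≤ ∫⁻ x, ‖f x‖ₑ ∂μ := by
    have h1 : ‖(((μ R).toReal⁻¹ : ℝ) : ℂ)‖ₑ = (μ R)⁻¹ := by
      rw [← enorm_norm, Complex.norm_real, enorm_norm, Real.enorm_eq_ofReal (by positivity),
        ENNReal.ofReal_inv_of_pos (ENNReal.toReal_pos hR0 hRt), ENNReal.ofReal_toReal hRt]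
    rw [hc, enorm_mul, h1, mul_right_comm, ENNReal.inv_mul_cancel hR0 hRt, one_mul]
    exact enorm_integral_le_lintegral_enorm _
  have hg : ∫⁻ x, ‖R.indicator (fun _ => c) x‖ₑ ∂μ ≤ ∫⁻ x, ‖f x‖ₑ ∂μ := by
    rw [lintegral_indicator_enorm]
    simpa using hcn
  have hgs : Function.support (R.indicator fun _ => c) ⊆ R := support_indicator_subset
  have hgi : Integrable (R.indicator fun _ => c) μ :=
    integrable_of_finite_support hμ (hR.subset hgs)
  have hhs : Function.support (f - R.indicator fun _ => c) ⊆ R :=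
    (Function.support_sub _ _).trans (union_subset hf hgs)
  refine ⟨R.indicator fun _ => c, f - R.indicator fun _ => c, E, by simp, hgs, hhs, fun x => ?_,
    hg, ?_, ?_⟩
  · rw [enorm_indicator_eq_indicator_enorm]
    refine indicator_le' (fun x _ => ?_) (fun _ _ => (zero_le : (0 : ℝ≥0∞) ≤ M)) x
    exact (ENNReal.mul_le_mul_iff_left hR0 hRt).1 (hcn.trans hM)
  · calc α * μ E ≤ 3 * (α * μ R) := by
          rw [mul_left_comm]; gcongr
      _ ≤ _ := by gcongr
  · refine (lintegral_kernelOp_le hμ hR hH hhs ?_).trans ?_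
    · simp only [Pi.sub_apply]
      rw [integral_sub hfi hgi, integral_indicator MeasurableSet.of_discrete, setIntegral_const,
        hc, Complex.real_smul, ← mul_assoc, measureReal_def, ← Complex.ofReal_mul,
        mul_inv_cancel₀ (ENNReal.toReal_pos hR0 hRt).ne']
      simp
    · rw [mul_comm 2 H, mul_assoc]
      gcongr
      rw [two_mul]
      refine (lintegral_mono fun x => enorm_sub_le).trans ?_
      rw [lintegral_add_left Measurable.of_discrete]
      gcongr

/-- The weak type `(1, 1)` estimate for finitely supported functions. -/
def IsWeakTypeOne (μ : Measure V) (K : V → V → ℂ) (W : ℝ≥0∞) : Prop :=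
  ∀ f : V → ℂ, (Function.support f).Finite → ∀ t : ℝ≥0∞, t ≠ 0 → t ≠ ∞ →
    t * μ {x | t < ‖kernelOp μ K f x‖ₑ} ≤ W * ∫⁻ x, ‖f x‖ₑ ∂μ

/-- The `L²` estimate for finitely supported functions. -/
def IsStrongTypeTwo (μ : Measure V) (K : V → V → ℂ) (N : ℝ≥0∞) : Prop :=
  ∀ f : V → ℂ, (Function.support f).Finite →
    ∫⁻ x, ‖kernelOp μ K f x‖ₑ ^ 2 ∂μ ≤ N * ∫⁻ x, ‖f x‖ₑ ^ 2 ∂μ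

/-- Chebyshev in `L²` for the good part, using `|g|² ≤ C t |g|`; the mass of `E`; Chebyshev in `L¹`
off `E` for the bad part. -/
theorem HasCZDecomposition.measure_le (hμ : ∀ x, μ {x} ≠ ∞) {N C H t : ℝ≥0∞}
    (hN : IsStrongTypeTwo μ K N) {R : Set V} (hR : R.Finite) {f : V → ℂ} (ht : t ≠ 0)
    (ht' : t ≠ ∞) (h : HasCZDecomposition μ K t (C * t) H R f) :
    t * μ {x | 2 * t < ‖kernelOp μ K f x‖ₑ} ≤ (N * C + 3 + 2 * H) * ∫⁻ x, ‖f x‖ₑ ∂μ := by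
  obtain ⟨g, b, E, hf, hg, hb, hM, hgf, hE, hH⟩ := h
  have hsub : {x | 2 * t < ‖kernelOp μ K f x‖ₑ} ⊆
      {x | t ^ 2 ≤ ‖kernelOp μ K g x‖ₑ ^ 2} ∪ E ∪ ({x | t ≤ ‖kernelOp μ K b x‖ₑ} ∩ Eᶜ) := by
    intro x hx
    by_cases hxE : x ∈ E
    · exact .inl (.inr hxE)
    by_contra hcon
    simp only [mem_union, mem_inter_iff, mem_ofPred_eq, mem_compl_iff, hxE, not_or, not_le,
      not_false_eq_true, and_true, or_false] at hcon
    refine (lt_irrefl (2 * t)) ((show 2 * t < _ from hx).trans_le ?_)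
    rw [hf, kernelOp_add hμ (hR.subset hg) (hR.subset hb), two_mul]
    refine (enorm_add_le _ _).trans (add_le_add ?_ hcon.2.le)
    exact (lt_of_not_ge fun h => hcon.1.not_ge (pow_le_pow_left' h 2)).le
  have h1 : t * μ {x | t ^ 2 ≤ ‖kernelOp μ K g x‖ₑ ^ 2} ≤ N * C * ∫⁻ x, ‖f x‖ₑ ∂μ := by
    rw [← ENNReal.mul_le_mul_iff_right ht ht', ← mul_assoc, ← sq]
    calc t ^ 2 * μ {x | t ^ 2 ≤ ‖kernelOp μ K g x‖ₑ ^ 2}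
        ≤ ∫⁻ x, ‖kernelOp μ K g x‖ₑ ^ 2 ∂μ := mul_meas_ge_le_lintegral Measurable.of_discrete _
      _ ≤ N * ∫⁻ x, ‖g x‖ₑ ^ 2 ∂μ := hN g (hR.subset hg)
      _ ≤ N * ∫⁻ x, C * t * ‖g x‖ₑ ∂μ := by
          gcongr with x
          rw [sq]
          gcongr
          exact hM x
      _ = N * (C * t * ∫⁻ x, ‖g x‖ₑ ∂μ) := by rw [lintegral_const_mul _ Measurable.of_discrete]
      _ ≤ N * (C * t * ∫⁻ x, ‖f x‖ₑ ∂μ) := by gcongr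
      _ = _ := by ring
  have h2 : t * μ ({x | t ≤ ‖kernelOp μ K b x‖ₑ} ∩ Eᶜ) ≤ 2 * H * ∫⁻ x, ‖f x‖ₑ ∂μ := by
    rw [← Measure.restrict_apply MeasurableSet.of_discrete]
    exact (mul_meas_ge_le_lintegral Measurable.of_discrete _).trans hH
  calc t * μ {x | 2 * t < ‖kernelOp μ K f x‖ₑ}
      ≤ t * (μ {x | t ^ 2 ≤ ‖kernelOp μ K g x‖ₑ ^ 2} + μ E +
          μ ({x | t ≤ ‖kernelOp μ K b x‖ₑ} ∩ Eᶜ)) := by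
        gcongr
        refine (measure_mono hsub).trans ((measure_union_le _ _).trans ?_)
        gcongr
        exact measure_union_le _ _
    _ ≤ _ := by
        rw [mul_add, mul_add, add_mul, add_mul]
        gcongr

end kernelOp

/-! ### The stopping-time argument and weak type `(1, 1)`. -/

namespace TreeAtInfinity

variable {V : Type*} [MeasurableSpace V] {T : TreeAtInfinity V} {m : V → ℝ}

theorem lintegral_le_hormanderConst {β : ℝ} {K : V → V → ℂ} {x₀ : V} {a b : ℕ}
    (h : AdmissibleParams β a b) {y z : V} (hy : y ∈ T.trapezoid x₀ a b)
    (hz : z ∈ T.trapezoid x₀ a b) :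
    ∫⁻ x in (T.enlargement x₀ a b)ᶜ, ‖K x y - K x z‖ₑ ∂(vertexMeasure m) ≤
      hormanderConst T m β K := by
  unfold hormanderConst
  exact le_iSup_of_le x₀ <| le_iSup_of_le a <| le_iSup_of_le b <| le_iSup_of_le h <|
    le_iSup_of_le y <| le_iSup_of_le hy <| le_iSup_of_le z <| le_iSup_of_le hz le_rfl

variable [DiscreteMeasurableSpace V]

/-- The invariant is that the average of `|f|` is at most `C * t`. Each cut starts from an average
at most `t` and produces pieces whose mass is smaller by a factor at most `C`, so the invariant is
inherited. The two lower bounds on `C` cover all the cuts. -/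
theorem hasCZDecomposition_trapezoid (hm : T.IsFlow m) (hd : T.IsLocallyDoubling m) {β : ℝ}
    (hβ : 12 ≤ β) {C D : ℝ≥0} (hD : ∀ x, m (T.father x) ≤ D * m x)
    (hC : β ≤ C) (hCD : 2 * (D + 1) ^ 2 ≤ C)
    (K : V → V → ℂ) {t : ℝ≥0∞} (x : V) {a b : ℕ}
    (hab : AdmissibleParams β a b) {f : V → ℂ} (hf : Function.support f ⊆ T.trapezoid x a b)
    (hL : ∫⁻ x, ‖f x‖ₑ ∂(vertexMeasure m) ≤ C * t * vertexMeasure m (T.trapezoid x a b)) :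
    HasCZDecomposition (vertexMeasure m) K t (C * t) (hormanderConst T m β K)
      (T.trapezoid x a b) f := by
  have := hm.countable hd
  have hfin := vertexMeasure_singleton_ne_top m
  have : SFinite (vertexMeasure m) := by unfold vertexMeasure; infer_instance
  have hD' : ∀ x, ENNReal.ofReal (m (T.father x)) ≤ D * ENNReal.ofReal (m x) := by
    intro x
    rw [← ENNReal.ofReal_coe_nnreal, ← ENNReal.ofReal_mul (NNReal.coe_nonneg D)]
    exact ENNReal.ofReal_le_ofReal (hD x)
  have hC2 : (2 : ℝ≥0) ≤ C := (le_mul_of_one_le_right' (one_le_pow₀ le_add_self)).trans hCD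
  have hDC : D ≤ C := le_trans (by nlinarith [D.2]) hCD
  -- This quantity drops under every cut: to `(a, 2a)` and `(2a, b)`, or to `(a - 1, b - 1)` in the
  -- sons.
  generalize hn : 2 * b - a = n
  induction n using Nat.strong_induction_on generalizing x a b f with
  | _ n ih =>
  obtain ⟨ha, hab2, habβ⟩ := admissibleParams_iff.1 hab
  -- Stop if the average of `|f|` is at least `t`.
  rcases le_total (t * vertexMeasure m (T.trapezoid x a b)) (∫⁻ x, ‖f x‖ₑ ∂(vertexMeasure m))
    with hlt | hle
  · refine hasCZDecomposition_of_average (E := T.enlargement x a b) hfin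
      (hm.finite_trapezoid hd x a b) ?_ (fun y hy z hz => lintegral_le_hormanderConst hab hy hz)
      (hm.measure_enlargement_le hd x hab2) hf hlt hL
    rw [hm.measure_trapezoid hd]
    refine mul_ne_zero (by exact_mod_cast (by omega : b - a ≠ 0)) ?_
    simpa using hm.1 x
  -- A tall trapezoid is cut at generation `2 * a`. The condition `4 * a ≤ b` makes the lower piece
  -- admissible. The mass ratios are `(b - a) / a ≤ β` and `(b - a) / (b - 2 * a) ≤ 2`.
  · by_cases hb4 : 4 * a ≤ b
    · have h1 : AdmissibleParams β a (2 * a) :=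
        admissibleParams_iff.2 ⟨ha, le_rfl, by push_cast; gcongr; linarith⟩
      have h2 : AdmissibleParams β (2 * a) b := by
        refine admissibleParams_iff.2 ⟨by omega, by omega, habβ.trans ?_⟩
        gcongr
        omega
      have hsplit := T.trapezoid_split x (a := a) (b := 2 * a) (c := b) (by omega) (by omega)
      have hdis := T.disjoint_trapezoid_level x a (2 * a) b
      have hsum := indicator_union_of_disjoint hdis f
      rw [← hsplit, indicator_eq_self.2 hf] at hsum
      have hle' : ∀ S : Set V, ∀ k : ℕ, ((b - a : ℕ) : ℝ) ≤ C * k →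
          ∫⁻ x, ‖S.indicator f x‖ₑ ∂(vertexMeasure m) ≤
            C * t * (k * ENNReal.ofReal (m x)) := by
        intro S k hk
        rw [lintegral_indicator_enorm]
        refine (setLIntegral_le_lintegral _ _).trans (hle.trans ?_)
        have hk : ((b - a : ℕ) : ℝ≥0) ≤ C * k := by exact_mod_cast hk
        have hk : ((b - a : ℕ) : ℝ≥0∞) ≤ C * k := by exact_mod_cast hk
        rw [hm.measure_trapezoid hd]
        calc t * (((b - a : ℕ) : ℝ≥0∞) * ENNReal.ofReal (m x))
            ≤ t * (C * k * ENNReal.ofReal (m x)) := by gcongr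
          _ = _ := by ring
      rw [hsplit, hsum]
      refine HasCZDecomposition.add hfin (hm.finite_trapezoid hd _ _ _)
        (hm.finite_trapezoid hd _ _ _) hdis support_indicator_subset support_indicator_subset
        (ih _ ?_ _ h1 support_indicator_subset ?_ rfl)
        (ih _ ?_ _ h2 support_indicator_subset ?_ rfl)
      · omega
      · rw [hm.measure_trapezoid hd]
        refine hle' _ _ ?_
        rw [Nat.cast_sub (by omega), Nat.cast_sub (by omega)]
        push_cast
        have : (0 : ℝ) < a := by exact_mod_cast ha
        nlinarith
      · omega
      · rw [hm.measure_trapezoid hd]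
        refine hle' _ _ ?_
        rw [Nat.cast_sub (by omega), Nat.cast_sub (by omega)]
        push_cast
        have : (4 : ℝ) * a ≤ b := by exact_mod_cast hb4
        have : (0 : ℝ) < a := by exact_mod_cast ha
        have : (2 : ℝ) ≤ C := by exact_mod_cast hC2
        nlinarith
    -- A low trapezoid with `a > 1` is cut along the sons of its root, at the cost of a factor `D`
    -- in mass. The pieces stay admissible: in the shifted parameters `b ≤ 4 * a + 2 ≤ 12 * a`, and
    -- here `12 ≤ β` is used.
    · rcases Nat.lt_or_ge 1 a with ha1 | ha1
      · obtain ⟨a, rfl⟩ : ∃ k, a = k + 1 := ⟨a - 1, by omega⟩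
        obtain ⟨b, rfl⟩ : ∃ k, b = k + 1 := ⟨b - 1, by omega⟩
        have h1 : AdmissibleParams β a b := by
          refine admissibleParams_iff.2 ⟨by omega, by omega, ?_⟩
          have : b ≤ 12 * a := by omega
          have : (b : ℝ) ≤ 12 * a := by exact_mod_cast this
          nlinarith [(Nat.cast_nonneg a : (0 : ℝ) ≤ a)]
        have hsons := hm.finite_sons hd x
        have heq : T.trapezoid x (a + 1) (b + 1) = ⋃ y ∈ hsons.toFinset, T.trapezoid y a b := by
          rw [T.trapezoid_succ]
          simp
        have hmeas := hm.measure_trapezoid hd x (a + 1) (b + 1)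
        rw [hmeas] at hle
        rw [heq] at hf ⊢
        refine hasCZDecomposition_iUnion hfin _ (fun y _ => hm.finite_trapezoid hd _ _ _) ?_ ?_
          hf hle
        · intro y hy z hz hyz
          exact T.disjoint_trapezoid_sons (by simpa using hy) (by simpa using hz) hyz a b
        · intro y hy g hg hgL
          refine ih _ ?_ y h1 hg (hgL.trans ?_) rfl
          · omega
          · rw [hm.measure_trapezoid hd, Nat.add_sub_add_right, mul_comm (C : ℝ≥0∞), mul_assoc t,
              mul_left_comm (C : ℝ≥0∞)]
            gcongr
            have hy' : T.father y = x := T.mem_sons.1 (by simpa using hy)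
            rw [← hy']
            refine (hD' y).trans ?_
            gcongr
      -- Here `a = 1` and `b` is 2 or 3, so only the first two generations occur. The trapezoid is
      -- cut into vertices, each of mass at least `m x / (D + 1) ^ 2`; there `f` is already bounded
      -- by `C * t` and is all good part.
      · have hR := hm.finite_trapezoid hd x a b
        have heq : T.trapezoid x a b = ⋃ y ∈ hR.toFinset, {y} := by simp
        rw [heq] at hf ⊢
        refine hasCZDecomposition_iUnion hfin _ (fun y _ => finite_singleton y) ?_ ?_ hf hle
        · intro y _ z _ hyz
          simpa using hyz
        · intro y hy g hg hgL
          refine hasCZDecomposition_of_bounded hg fun z => ?_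
          by_cases hz : g z = 0
          · simp [hz]
          obtain rfl : z = y := hg hz
          rw [lintegral_enorm_eq_setLIntegral hg, lintegral_singleton] at hgL
          have h0 := hm.measure_singleton_ne_zero z
          refine (ENNReal.mul_le_mul_iff_left h0 (hfin z)).1 (hgL.trans ?_)
          rw [hm.measure_trapezoid hd, vertexMeasure_singleton, mul_comm (C : ℝ≥0∞), mul_assoc t]
          refine mul_le_mul_right ?_ t
          obtain ⟨k, hk1, hk2, hk⟩ := T.mem_trapezoid.1 ((hR.mem_toFinset).1 hy)
          have hmx : ENNReal.ofReal (m x) ≤ (D + 1) ^ 2 * ENNReal.ofReal (m z) := by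
            have hk : T.father^[k] z = x := hk
            obtain rfl | rfl : k = 1 ∨ k = 2 := by omega
            · rw [← hk]
              refine (hD' z).trans ?_
              gcongr
              calc (D : ℝ≥0∞) ≤ D + 1 := le_self_add
                _ ≤ (D + 1) ^ 2 := le_self_pow₀ le_add_self two_ne_zero
            · rw [← hk]
              refine (hD' (T.father z)).trans ((mul_le_mul_right (hD' z) _).trans ?_)
              rw [← mul_assoc, sq]
              gcongr <;> exact le_self_add
          calc ((b - a : ℕ) : ℝ≥0∞) * ENNReal.ofReal (m x)
              ≤ 2 * ((D + 1) ^ 2 * ENNReal.ofReal (m z)) := by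
                gcongr
                exact_mod_cast (by omega : b - a ≤ 2)
            _ ≤ _ := by
                rw [← mul_assoc]
                refine mul_le_mul_left ?_ _
                exact_mod_cast hCD

theorem IsFlow.tendsto_measure_trapezoid (hm : T.IsFlow m) (hd : T.IsLocallyDoubling m) :
    Filter.Tendsto (fun k : ℕ => vertexMeasure m (T.trapezoid (T.ray (2 * k)) k (12 * k)))
      Filter.atTop (nhds ∞) := by
  have h : Filter.Tendsto (fun k : ℕ => (k : ℝ≥0∞) * ENNReal.ofReal (m (T.ray 0)))
      Filter.atTop (nhds ∞) := by
    have h1 := ENNReal.Tendsto.mul_const (b := ENNReal.ofReal (m (T.ray 0)))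
      ENNReal.tendsto_nat_nhds_top (.inl ENNReal.top_ne_zero)
    rwa [ENNReal.top_mul] at h1
    simpa using hm.1 _
  refine tendsto_nhds_top_mono h (Filter.Eventually.of_forall fun k => ?_)
  dsimp only
  rw [hm.measure_trapezoid hd]
  gcongr
  · omega
  · rw [← T.iterate_father_ray (2 * k)]
    exact hm.le_iterate _ _

theorem admissibleParams_ray {β : ℝ} (hβ : 12 ≤ β) {k : ℕ} (hk : 0 < k) :
    AdmissibleParams β k (12 * k) :=
  admissibleParams_iff.2 ⟨hk, by omega, by push_cast; gcongr⟩

/-- The stopping-time argument needs a starting trapezoid. One along the ray contains the support of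
`f` and, as these masses tend to infinity, can be chosen so large that the average of `|f|` is below
`t`. -/
theorem IsFlow.isWeakTypeOne (hm : T.IsFlow m) (hd : T.IsLocallyDoubling m) {β : ℝ}
    (hβ : 12 ≤ β) {K : V → V → ℂ} {N : ℝ≥0∞} (hN : IsStrongTypeTwo (vertexMeasure m) K N)
    (hN' : N ≠ ∞) (hK : hormanderConst T m β K < ∞) :
    ∃ W : ℝ≥0∞, W ≠ ∞ ∧ IsWeakTypeOne (vertexMeasure m) K W := by
  obtain ⟨D, -, hD⟩ := hm.exists_father_le hd
  have hfin := vertexMeasure_singleton_ne_top m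
  let C : ℝ≥0 := β.toNNReal + 2 * (D + 1) ^ 2
  have hC : β ≤ C := (Real.le_coe_toNNReal β).trans (by exact_mod_cast le_self_add)
  have hCD : 2 * (D + 1) ^ 2 ≤ C := le_add_self
  have hC1 : (1 : ℝ≥0) ≤ C :=
    (one_le_mul one_le_two (one_le_pow₀ le_add_self)).trans hCD
  refine ⟨2 * (N * C + 3 + 2 * hormanderConst T m β K), by finiteness, fun f hf s hs hs' => ?_⟩
  obtain ⟨t, rfl⟩ : ∃ t, s = 2 * t := ⟨s / 2, (ENNReal.mul_div_cancel (by simp) (by simp)).symm⟩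
  have ht : t ≠ 0 := right_ne_zero_of_mul hs
  have ht' : t ≠ ∞ := by rintro rfl; simp at hs'
  have hev : ∀ᶠ k in Filter.atTop,
      Function.support f ⊆ T.trapezoid (T.ray (2 * k)) k (12 * k) := by
    have : ∀ x ∈ Function.support f,
        ∀ᶠ k in Filter.atTop, x ∈ T.trapezoid (T.ray (2 * k)) k (12 * k) := by
      intro x _
      obtain ⟨n, hn⟩ := T.exists_mem_trapezoid_ray x
      exact Filter.eventually_atTop.2 ⟨n, hn⟩
    exact (Filter.eventually_all_finite hf).2 this
  have hint : ∫⁻ x, ‖f x‖ₑ ∂(vertexMeasure m) < ∞ := (integrable_of_finite_support hfin hf).2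
  have hmass := (hm.tendsto_measure_trapezoid hd).eventually_const_lt
    (ENNReal.div_lt_top hint.ne ht)
  obtain ⟨k, ⟨hk1, hk2⟩, hk0⟩ := ((hev.and hmass).and (Filter.eventually_gt_atTop 0)).exists
  rw [mul_assoc, mul_assoc]
  refine mul_le_mul_right ?_ 2
  refine HasCZDecomposition.measure_le hfin hN (hm.finite_trapezoid hd _ _ _) ht ht'
    (hasCZDecomposition_trapezoid hm hd hβ hD hC hCD K _ (admissibleParams_ray hβ hk0)
      hk1 ?_)
  rw [ENNReal.div_lt_iff (.inl ht) (.inl ht')] at hk2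
  refine hk2.le.trans ?_
  rw [mul_comm]
  gcongr
  exact le_mul_of_one_le_left' (by exact_mod_cast hC1)

end TreeAtInfinity

/-! ### Marcinkiewicz interpolation between weak type `(1, 1)` and `L²`. -/

section Marcinkiewicz

/-- The inner integral, with `a = |f x|`, for the part of `f` above height `t`; it converges at 0
because `p > 1`. -/
theorem lintegral_Ioi_rpow_lt_le {p : ℝ} (hp : 1 < p) {a : ℝ} (ha : 0 ≤ a) :
    ∫⁻ t in Ioi (0 : ℝ), ENNReal.ofReal (t ^ (p - 2)) * (if t < a then ENNReal.ofReal a else 0) ≤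
      ENNReal.ofReal (p - 1)⁻¹ * ENNReal.ofReal (a ^ p) := by
  rcases ha.eq_or_lt with rfl | ha
  · simp
  have h1 : ∀ t, ENNReal.ofReal (t ^ (p - 2)) * (if t < a then ENNReal.ofReal a else 0) =
      (Iio a).indicator (fun t => ENNReal.ofReal (t ^ (p - 2)) * ENNReal.ofReal a) t := by
    intro t
    by_cases h : t < a <;> simp [h]
  simp only [h1]
  rw [lintegral_indicator measurableSet_Iio, Measure.restrict_restrict measurableSet_Iio,
    lintegral_mul_const' _ _ ENNReal.ofReal_ne_top, inter_comm, Ioi_inter_Iio]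
  have hi : IntervalIntegrable (fun t : ℝ => t ^ (p - 2)) volume 0 a :=
    intervalIntegral.intervalIntegrable_rpow' (by linarith)
  rw [intervalIntegrable_iff_integrableOn_Ioo_of_le ha.le] at hi
  rw [← ofReal_integral_eq_lintegral_ofReal hi, ← integral_Ioc_eq_integral_Ioo,
    ← intervalIntegral.integral_of_le ha.le, integral_rpow (.inl (by linarith)),
    ← ENNReal.ofReal_mul' ha.le, ← ENNReal.ofReal_mul (by simp; linarith)]
  · refine ENNReal.ofReal_le_ofReal (le_of_eq ?_)
    rw [Real.zero_rpow (by linarith), show p - 2 + 1 = p - 1 by ring, Real.rpow_sub_one ha.ne']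
    field_simp
    ring
  · refine (ae_restrict_iff' measurableSet_Ioo).2 (ae_of_all _ fun t ht => ?_)
    exact Real.rpow_nonneg ht.1.le _

/-- The counterpart for the part of `f` at most `t`; it converges at infinity because `p < 2`. -/
theorem lintegral_Ioi_rpow_ge_le {p : ℝ} (hp : p < 2) {a : ℝ} (ha : 0 ≤ a) :
    ∫⁻ t in Ioi (0 : ℝ), ENNReal.ofReal (t ^ (p - 3)) *
        (if t < a then 0 else ENNReal.ofReal (a ^ 2)) ≤
      ENNReal.ofReal (2 - p)⁻¹ * ENNReal.ofReal (a ^ p) := by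
  rcases ha.eq_or_lt with rfl | ha
  · simp
  have h1 : ∀ t, ENNReal.ofReal (t ^ (p - 3)) * (if t < a then 0 else ENNReal.ofReal (a ^ 2)) =
      (Ici a).indicator (fun t => ENNReal.ofReal (t ^ (p - 3)) * ENNReal.ofReal (a ^ 2)) t := by
    intro t
    by_cases h : t < a
    · simp [h]
    · simp [h, not_lt.1 h]
  simp only [h1]
  rw [lintegral_indicator measurableSet_Ici, Measure.restrict_restrict measurableSet_Ici,
    lintegral_mul_const' _ _ ENNReal.ofReal_ne_top,
    show Ici a ∩ Ioi 0 = Ici a from inter_eq_self_of_subset_left fun t ht => ha.trans_le ht,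
    setLIntegral_congr Ioi_ae_eq_Ici.symm,
    ← ofReal_integral_eq_lintegral_ofReal (integrableOn_Ioi_rpow_of_lt (by linarith) ha),
    integral_Ioi_rpow_of_lt (by linarith) ha,
    ← ENNReal.ofReal_mul' (by positivity), ← ENNReal.ofReal_mul (by simp; linarith)]
  · refine ENNReal.ofReal_le_ofReal (le_of_eq ?_)
    rw [show p - 3 + 1 = p - (2 : ℕ) by push_cast; ring, Real.rpow_sub_natCast ha.ne']
    have : 2 - p ≠ 0 := by linarith
    have : p - 2 ≠ 0 := by linarith
    push_cast
    field_simp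
    ring
  · refine (ae_restrict_iff' measurableSet_Ioi).2 (ae_of_all _ fun t ht => ?_)
    exact Real.rpow_nonneg (ha.trans ht).le _

variable {V : Type*} [MeasurableSpace V] [DiscreteMeasurableSpace V] {μ : Measure V}
  {K : V → V → ℂ}

/-- Split `f` at height `t`, with the weak type bound on the large part and the `L²` bound on the
small part, each at level `t / 2`. The factors 2 and 4 are `t / (t / 2)` and its square. -/
theorem measure_lt_mul_rpow_le (hμ : ∀ x, μ {x} ≠ ∞) {W N : ℝ≥0∞} (hW : IsWeakTypeOne μ K W)
    (hN : IsStrongTypeTwo μ K N) (p : ℝ) {f : V → ℂ} (hf : (Function.support f).Finite)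
    {t : ℝ} (ht : 0 < t) :
    μ {x | t < ‖kernelOp μ K f x‖} * ENNReal.ofReal (t ^ (p - 1)) ≤
      2 * W * ∫⁻ x, ENNReal.ofReal (t ^ (p - 2)) *
        (if t < ‖f x‖ then ENNReal.ofReal ‖f x‖ else 0) ∂μ +
      4 * N * ∫⁻ x, ENNReal.ofReal (t ^ (p - 3)) *
        (if t < ‖f x‖ then 0 else ENNReal.ofReal (‖f x‖ ^ 2)) ∂μ := by
  set S : Set V := {x | t < ‖f x‖}
  have hfS : (Function.support (S.indicator f)).Finite := hf.subset (by simp)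
  have hfS' : (Function.support (Sᶜ.indicator f)).Finite := hf.subset (by simp)
  set u : ℝ≥0∞ := ENNReal.ofReal (t / 2)
  have hu : u ≠ 0 := by simpa [u] using ht
  have hu' : u ≠ ∞ := ENNReal.ofReal_ne_top
  have h1 := hW _ hfS u hu hu'
  have h2 : u ^ 2 * μ {x | u ^ 2 ≤ ‖kernelOp μ K (Sᶜ.indicator f) x‖ₑ ^ 2} ≤
      N * ∫⁻ x, ‖Sᶜ.indicator f x‖ₑ ^ 2 ∂μ :=
    (mul_meas_ge_le_lintegral Measurable.of_discrete _).trans (hN _ hfS')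
  have hsub : {x | t < ‖kernelOp μ K f x‖} ⊆ {x | u < ‖kernelOp μ K (S.indicator f) x‖ₑ} ∪
      {x | u ^ 2 ≤ ‖kernelOp μ K (Sᶜ.indicator f) x‖ₑ ^ 2} := by
    intro x hx
    by_contra hcon
    simp only [mem_union, mem_ofPred_eq, not_or, not_lt, not_le] at hcon
    have h3 : ‖kernelOp μ K (Sᶜ.indicator f) x‖ₑ < u :=
      lt_of_not_ge fun h => hcon.2.not_ge (pow_le_pow_left' h 2)
    have h4 : ‖kernelOp μ K f x‖ₑ ≤ u + u := by
      conv_lhs => rw [← indicator_self_add_compl S f, kernelOp_add hμ hfS hfS']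
      exact (enorm_add_le _ _).trans (add_le_add hcon.1 h3.le)
    rw [← ENNReal.ofReal_add (by positivity) (by positivity), ← ofReal_norm,
      ENNReal.ofReal_le_ofReal_iff (by positivity)] at h4
    linarith [show t < _ from hx]
  have e1 : ENNReal.ofReal (t ^ (p - 1)) = u * (2 * ENNReal.ofReal (t ^ (p - 2))) := by
    rw [show (2 : ℝ≥0∞) = ENNReal.ofReal 2 by simp, ← ENNReal.ofReal_mul (by positivity),
      ← ENNReal.ofReal_mul (by positivity), show p - 1 = p - 2 + 1 by ring,
      Real.rpow_add_one ht.ne']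
    congr 1
    ring
  have e2 : ENNReal.ofReal (t ^ (p - 1)) = u ^ 2 * (4 * ENNReal.ofReal (t ^ (p - 3))) := by
    rw [show (4 : ℝ≥0∞) = ENNReal.ofReal 4 by simp, ← ENNReal.ofReal_pow (by positivity),
      ← ENNReal.ofReal_mul (by positivity),
      ← ENNReal.ofReal_mul (by positivity), show p - 1 = p - 3 + (2 : ℕ) by push_cast; ring,
      Real.rpow_add_natCast ht.ne']
    congr 1
    ring
  have i1 : ∀ x, (if t < ‖f x‖ then ENNReal.ofReal ‖f x‖ else 0) = ‖S.indicator f x‖ₑ := by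
    intro x
    by_cases hx : x ∈ S
    · rw [indicator_of_mem hx, if_pos (show t < ‖f x‖ from hx), ofReal_norm]
    · rw [indicator_of_notMem hx, if_neg (show ¬ t < ‖f x‖ from hx), enorm_zero]
  have i2 : ∀ x, (if t < ‖f x‖ then 0 else ENNReal.ofReal (‖f x‖ ^ 2)) =
      ‖Sᶜ.indicator f x‖ₑ ^ 2 := by
    intro x
    by_cases hx : x ∈ S
    · rw [indicator_of_notMem (by simpa using hx), if_pos (show t < ‖f x‖ from hx)]
      simp
    · rw [indicator_of_mem (by simpa using hx), if_neg (show ¬ t < ‖f x‖ from hx), ENNReal.ofReal_pow (norm_nonneg _),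
        ofReal_norm]
  simp only [i1, i2]
  rw [lintegral_const_mul _ Measurable.of_discrete, lintegral_const_mul _ Measurable.of_discrete]
  calc μ {x | t < ‖kernelOp μ K f x‖} * ENNReal.ofReal (t ^ (p - 1))
      ≤ (μ {x | u < ‖kernelOp μ K (S.indicator f) x‖ₑ} +
          μ {x | u ^ 2 ≤ ‖kernelOp μ K (Sᶜ.indicator f) x‖ₑ ^ 2}) *
            ENNReal.ofReal (t ^ (p - 1)) := by
        gcongr
        exact (measure_mono hsub).trans (measure_union_le _ _)
    _ = (u * μ {x | u < ‖kernelOp μ K (S.indicator f) x‖ₑ}) *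
          (2 * ENNReal.ofReal (t ^ (p - 2))) +
        (u ^ 2 * μ {x | u ^ 2 ≤ ‖kernelOp μ K (Sᶜ.indicator f) x‖ₑ ^ 2}) *
          (4 * ENNReal.ofReal (t ^ (p - 3))) := by
        rw [add_mul]
        nth_rw 1 [e1]
        rw [e2]
        ring
    _ ≤ (W * ∫⁻ x, ‖S.indicator f x‖ₑ ∂μ) * (2 * ENNReal.ofReal (t ^ (p - 2))) +
        (N * ∫⁻ x, ‖Sᶜ.indicator f x‖ₑ ^ 2 ∂μ) * (4 * ENNReal.ofReal (t ^ (p - 3))) := by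
        gcongr
    _ = _ := by ring

/-- The Marcinkiewicz interpolation theorem between weak type `(1, 1)` and `L²`. -/
theorem IsWeakTypeOne.lintegral_rpow_le [Countable V] [SFinite μ] (hμ : ∀ x, μ {x} ≠ ∞)
    {W N : ℝ≥0∞} (hW : IsWeakTypeOne μ K W) (hN : IsStrongTypeTwo μ K N) {p : ℝ} (hp : 1 < p)
    (hp' : p < 2) {f : V → ℂ} (hf : (Function.support f).Finite) :
    ∫⁻ x, ‖kernelOp μ K f x‖ₑ ^ p ∂μ ≤
      ENNReal.ofReal p * (2 * W * ENNReal.ofReal (p - 1)⁻¹ + 4 * N * ENNReal.ofReal (2 - p)⁻¹) *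
        ∫⁻ x, ‖f x‖ₑ ^ p ∂μ := by
  have hp0 : 0 < p := by linarith
  have hrpow : ∀ z : ℂ, ‖z‖ₑ ^ p = ENNReal.ofReal (‖z‖ ^ p) := fun z => by
    rw [← ofReal_norm, ENNReal.ofReal_rpow_of_nonneg (norm_nonneg _) hp0.le]
  simp only [hrpow]
  rw [lintegral_rpow_eq_lintegral_meas_lt_mul μ (ae_of_all _ fun x => norm_nonneg _)
    Measurable.of_discrete.aemeasurable hp0, mul_assoc]
  refine mul_le_mul_right ?_ _
  have hm : ∀ r : ℝ, Measurable fun t : ℝ => ENNReal.ofReal (t ^ r) := fun r => by fun_prop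
  have m1 : Measurable (Function.uncurry fun (t : ℝ) (x : V) => ENNReal.ofReal (t ^ (p - 2)) *
      (if t < ‖f x‖ then ENNReal.ofReal ‖f x‖ else 0)) := by
    refine measurable_from_prod_countable_left fun x => ?_
    change Measurable fun t : ℝ => ENNReal.ofReal (t ^ (p - 2)) *
      (if t < ‖f x‖ then ENNReal.ofReal ‖f x‖ else 0)
    exact (hm _).mul (Measurable.ite (measurableSet_lt measurable_id measurable_const) measurable_const measurable_const)
  have m2 : Measurable (Function.uncurry fun (t : ℝ) (x : V) => ENNReal.ofReal (t ^ (p - 3)) *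
      (if t < ‖f x‖ then 0 else ENNReal.ofReal (‖f x‖ ^ 2))) := by
    refine measurable_from_prod_countable_left fun x => ?_
    change Measurable fun t : ℝ => ENNReal.ofReal (t ^ (p - 3)) *
      (if t < ‖f x‖ then 0 else ENNReal.ofReal (‖f x‖ ^ 2))
    exact (hm _).mul (Measurable.ite (measurableSet_lt measurable_id measurable_const) measurable_const measurable_const)
  calc ∫⁻ t in Ioi 0, μ {x | t < ‖kernelOp μ K f x‖} * ENNReal.ofReal (t ^ (p - 1))
      ≤ ∫⁻ t in Ioi 0, (2 * W * ∫⁻ x, ENNReal.ofReal (t ^ (p - 2)) *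
        (if t < ‖f x‖ then ENNReal.ofReal ‖f x‖ else 0) ∂μ +
      4 * N * ∫⁻ x, ENNReal.ofReal (t ^ (p - 3)) *
        (if t < ‖f x‖ then 0 else ENNReal.ofReal (‖f x‖ ^ 2)) ∂μ) :=
        setLIntegral_mono' measurableSet_Ioi fun t ht => measure_lt_mul_rpow_le hμ hW hN p hf ht
    _ = 2 * W * ∫⁻ x, (∫⁻ t in Ioi 0, ENNReal.ofReal (t ^ (p - 2)) *
          (if t < ‖f x‖ then ENNReal.ofReal ‖f x‖ else 0)) ∂μ +
        4 * N * ∫⁻ x, (∫⁻ t in Ioi 0, ENNReal.ofReal (t ^ (p - 3)) *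
          (if t < ‖f x‖ then 0 else ENNReal.ofReal (‖f x‖ ^ 2))) ∂μ := by
        rw [lintegral_add_left (m1.lintegral_prod_right.const_mul _),
          lintegral_const_mul _ m1.lintegral_prod_right,
          lintegral_const_mul _ m2.lintegral_prod_right,
          lintegral_lintegral_swap m1.aemeasurable, lintegral_lintegral_swap m2.aemeasurable]
    _ ≤ 2 * W * ∫⁻ x, ENNReal.ofReal (p - 1)⁻¹ * ENNReal.ofReal (‖f x‖ ^ p) ∂μ +
        4 * N * ∫⁻ x, ENNReal.ofReal (2 - p)⁻¹ * ENNReal.ofReal (‖f x‖ ^ p) ∂μ := by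
        gcongr with x x
        · exact lintegral_Ioi_rpow_lt_le hp (norm_nonneg _)
        · exact lintegral_Ioi_rpow_ge_le hp' (norm_nonneg _)
    _ = _ := by
        rw [lintegral_const_mul _ Measurable.of_discrete,
          lintegral_const_mul _ Measurable.of_discrete]
        ring

end Marcinkiewicz

/-! ### Duality, and estimates beyond finitely supported functions. -/

section StrongType

variable {V : Type*} [MeasurableSpace V]

/-- The `Lᵖ` estimate for finitely supported functions. -/
def IsStrongType (μ : Measure V) (K : V → V → ℂ) (p : ℝ) (C : ℝ≥0∞) : Prop :=
  ∀ f : V → ℂ, (Function.support f).Finite →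
    ∫⁻ x, ‖kernelOp μ K f x‖ₑ ^ p ∂μ ≤ C * ∫⁻ x, ‖f x‖ₑ ^ p ∂μ

variable {μ : Measure V} {K : V → V → ℂ}

theorem isStrongType_two_iff {N : ℝ≥0∞} : IsStrongType μ K 2 N ↔ IsStrongTypeTwo μ K N := by
  simp only [IsStrongType, IsStrongTypeTwo, ENNReal.rpow_two]

variable [DiscreteMeasurableSpace V]

theorem kernelOp_indicator_singleton (y : V) (x : V) :
    kernelOp μ K (({y} : Set V).indicator 1) x = μ.real {y} • K x y := by
  have : ∀ z, K x z * ({y} : Set V).indicator 1 z = ({y} : Set V).indicator (K x) z := by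
    intro z
    by_cases hz : z ∈ ({y} : Set V) <;> simp [hz]
  simp only [kernelOp, this]
  rw [integral_indicator MeasurableSet.of_discrete, integral_singleton]

theorem enorm_kernelOp_indicator_singleton (hμ : ∀ x, μ {x} ≠ ∞) (y : V) (x : V) :
    ‖kernelOp μ K (({y} : Set V).indicator 1) x‖ₑ = μ {y} * ‖K x y‖ₑ := by
  rw [kernelOp_indicator_singleton, enorm_smul, measureReal_def,
    Real.enorm_eq_ofReal ENNReal.toReal_nonneg, ENNReal.ofReal_toReal (hμ y)]

variable [Countable V]

theorem lintegral_le_of_forall_finset {F : V → ℝ≥0∞} {B : ℝ≥0∞}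
    (h : ∀ s : Finset V, ∫⁻ x in s, F x ∂μ ≤ B) : ∫⁻ x, F x ∂μ ≤ B := by
  rw [lintegral_countable', ENNReal.tsum_eq_iSup_sum]
  refine iSup_le fun s => ?_
  rw [← lintegral_finset]
  exact h s

theorem exists_finite_exhaustion (V : Type*) [Countable V] :
    ∃ F : ℕ → Set V, (∀ n, (F n).Finite) ∧ ∀ x, ∀ᶠ n in Filter.atTop, x ∈ F n := by
  obtain ⟨e, he⟩ := Countable.exists_injective_nat V
  refine ⟨fun n => e ⁻¹' Iio n, fun n => (finite_Iio n).preimage he.injOn, fun x => ?_⟩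
  exact Filter.eventually_atTop.2 ⟨e x + 1, fun n hn => (Nat.lt_of_succ_le hn : e x < n)⟩

/-- Truncate `g` to finite sets: the images converge pointwise by dominated convergence, and Fatou
carries the estimate to the limit. -/
theorem IsStrongType.lintegral_kernelOp_rpow_le {p : ℝ} (hp : 0 < p)
    {C : ℝ≥0∞} (h : IsStrongType μ K p C) {g : V → ℂ}
    (hi : ∀ x, Integrable (fun y => K x y * g y) μ) :
    ∫⁻ x, ‖kernelOp μ K g x‖ₑ ^ p ∂μ ≤ C * ∫⁻ x, ‖g x‖ₑ ^ p ∂μ := by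
  obtain ⟨F, hF, hx⟩ := exists_finite_exhaustion V
  have hlim : ∀ x, Filter.Tendsto (fun n => kernelOp μ K ((F n).indicator g) x) Filter.atTop
      (nhds (kernelOp μ K g x)) := by
    intro x
    refine tendsto_integral_of_dominated_convergence (fun y => ‖K x y * g y‖)
      (fun n => Measurable.of_discrete.aestronglyMeasurable) (hi x).norm
      (fun n => ae_of_all _ fun y => ?_) (ae_of_all _ fun y => ?_)
    · rw [norm_mul, norm_mul]
      gcongr
      exact norm_indicator_le_norm_self _ _
    · refine tendsto_const_nhds.congr' ?_
      filter_upwards [hx y] with n hn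
      rw [indicator_of_mem hn]
  calc ∫⁻ x, ‖kernelOp μ K g x‖ₑ ^ p ∂μ
      = ∫⁻ x, Filter.liminf (fun n => ‖kernelOp μ K ((F n).indicator g) x‖ₑ ^ p)
          Filter.atTop ∂μ := by
        refine lintegral_congr fun x => (Filter.Tendsto.liminf_eq ?_).symm
        exact (((ENNReal.continuous_rpow_const (y := p)).comp (continuous_enorm (E := ℂ))).tendsto
          _).comp (hlim x)
    _ ≤ Filter.liminf (fun n => ∫⁻ x, ‖kernelOp μ K ((F n).indicator g) x‖ₑ ^ p ∂μ)
          Filter.atTop := lintegral_liminf_le fun n => Measurable.of_discrete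
    _ ≤ C * ∫⁻ x, ‖g x‖ₑ ^ p ∂μ := by
        refine Filter.liminf_le_of_frequently_le' (Filter.Frequently.of_forall fun n => ?_)
        refine (h _ ((hF n).subset support_indicator_subset)).trans ?_
        gcongr with x
        exact enorm_indicator_le_enorm_self _ _

/-- A kernel of weak type `(1, 1)` is bounded in its second variable. -/
theorem IsWeakTypeOne.enorm_kernel_le (hμ : ∀ x, μ {x} ≠ ∞) (hμ0 : ∀ x, μ {x} ≠ 0) {W : ℝ≥0∞}
    (hW : IsWeakTypeOne μ K W) (x y : V) : ‖K x y‖ₑ ≤ W / μ {x} := by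
  rw [ENNReal.le_div_iff_mul_le (.inl (hμ0 x)) (.inl (hμ x)),
    ← ENNReal.mul_le_mul_iff_right (hμ0 y) (hμ y), ← mul_assoc]
  rw [← ENNReal.le_div_iff_mul_le (.inl (hμ0 x)) (.inl (hμ x))]
  refine le_of_forall_lt fun t ht => ?_
  -- The image of the indicator of `y` has modulus `μ {y} * |K x y|` at `x`. A level `s` strictly
  -- below this value puts `x` in the level set, and weak type then bounds `s * μ {x}`.
  obtain ⟨s, hts, hs⟩ := exists_between ht
  refine hts.trans_le ?_
  rw [ENNReal.le_div_iff_mul_le (.inl (hμ0 x)) (.inl (hμ x))]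
  have h := hW (({y} : Set V).indicator 1) ((finite_singleton y).subset support_indicator_subset)
    s (zero_le.trans_lt hts).ne' hs.ne_top
  have h1 : ∫⁻ z, ‖({y} : Set V).indicator (1 : V → ℂ) z‖ₑ ∂μ = μ {y} := by
    rw [lintegral_indicator_enorm, lintegral_singleton]
    simp
  rw [h1, mul_comm W] at h
  refine le_trans ?_ h
  gcongr
  refine singleton_subset_iff.2 ?_
  rw [mem_ofPred_eq, enorm_kernelOp_indicator_singleton hμ]
  exact hs

variable [SFinite μ]

theorem integral_kernelOp_mul (hμ : ∀ x, μ {x} ≠ ∞) {f g : V → ℂ}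
    (hf : (Function.support f).Finite) (hg : (Function.support g).Finite) :
    ∫ x, kernelOp μ (fun x y => K y x) g x * f x ∂μ = ∫ y, g y * kernelOp μ K f y ∂μ := by
  simp only [kernelOp, ← integral_const_mul, ← integral_mul_const]
  rw [integral_integral_swap]
  · congr! 4
    ring
  · refine integrable_of_finite_support (fun z => ?_) ((hf.prod hg).subset ?_)
    · rw [← Prod.mk.eta (p := z), ← singleton_prod_singleton, Measure.prod_prod]
      exact ENNReal.mul_ne_top (hμ _) (hμ _)
    · rintro ⟨x, y⟩ h
      simp only [Function.uncurry_apply_pair, Function.mem_support, ne_eq, mul_eq_zero,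
        not_or] at h
      exact ⟨h.2, h.1.2⟩

/-- The transposed kernel is bounded on the dual Lebesgue space. -/
theorem IsStrongType.transpose (hμ : ∀ x, μ {x} ≠ ∞) {p q : ℝ} (hpq : p.HolderConjugate q)
    {C : ℝ≥0∞} (h : IsStrongType μ K p C) :
    IsStrongType μ (fun x y => K y x) q (C ^ (q / p)) := by
  intro g hg
  have hp0 := hpq.pos
  have hq0 := hpq.symm.pos
  -- Restricting to a finite set makes the integral `X` below finite, so that it may be divided out
  -- at the end.
  refine lintegral_le_of_forall_finset fun s => ?_
  set u := kernelOp μ (fun x y => K y x) g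
  set X := ∫⁻ x in s, ‖u x‖ₑ ^ q ∂μ with hX
  set G := ∫⁻ x, ‖g x‖ₑ ^ q ∂μ with hG
  -- The extremal function in Hölder's inequality: `u * φ = |u| ^ q` and `|φ| ^ p = |u| ^ q`.
  let φ : V → ℂ := fun x => starRingEnd ℂ (u x) * ((‖u x‖ ^ (q - 2) : ℝ) : ℂ)
  let f : V → ℂ := (s : Set V).indicator φ
  have hfs : (Function.support f).Finite := s.finite_toSet.subset support_indicator_subset
  have hφ : ∀ x, u x * φ x = ((‖u x‖ ^ q : ℝ) : ℂ) := by
    intro x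
    by_cases hx : u x = 0
    · simp [hx, Real.zero_rpow hq0.ne']
    · have hpos : 0 < ‖u x‖ := norm_pos_iff.2 hx
      simp only [φ]
      rw [← mul_assoc, Complex.mul_conj, Complex.normSq_eq_norm_sq, ← Complex.ofReal_mul,
        show q = (2 : ℕ) + (q - 2) by push_cast; ring, Real.rpow_add hpos, Real.rpow_natCast]
      congr 3
      ring
  have hφn : ∀ x, ‖φ x‖ₑ ^ p = ‖u x‖ₑ ^ q := by
    intro x
    by_cases hx : u x = 0
    · simp [φ, hx, hp0, hq0]
    · have h1 : ‖u x‖ₑ * ‖φ x‖ₑ = ‖u x‖ₑ ^ q := by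
        rw [← enorm_mul, hφ, ← enorm_norm, Complex.norm_real, enorm_norm,
          Real.enorm_eq_ofReal (by positivity), ← ofReal_norm,
          ENNReal.ofReal_rpow_of_nonneg (norm_nonneg _) hq0.le]
      have hu0 : ‖u x‖ₑ ≠ 0 := by simpa using hx
      have h2 : ‖φ x‖ₑ = ‖u x‖ₑ ^ (q - 1) := by
        rw [ENNReal.rpow_sub _ _ hu0 enorm_ne_top, ENNReal.rpow_one,
          ENNReal.eq_div_iff hu0 enorm_ne_top, h1]
      rw [h2, ← ENNReal.rpow_mul, hpq.symm.sub_one_mul_conj]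
  have hXt : X ≠ ∞ := by
    rw [hX, lintegral_finset]
    refine (ENNReal.sum_lt_top.2 fun x _ => ?_).ne
    have := (hμ x).lt_top
    have : ‖u x‖ₑ ^ q ≠ ∞ := ENNReal.rpow_ne_top_of_nonneg hq0.le enorm_ne_top
    finiteness
  have hfX : ∫⁻ x, ‖f x‖ₑ ^ p ∂μ = X := by
    rw [hX, ← lintegral_indicator MeasurableSet.of_discrete]
    refine lintegral_congr fun x => ?_
    by_cases hx : x ∈ (s : Set V)
    · simp only [f, indicator_of_mem hx, hφn]
    · simp [f, indicator_of_notMem hx, hp0]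
  have hXint : X = ‖∫ x, u x * f x ∂μ‖ₑ := by
    have h1 : ∀ x, u x * f x = (s : Set V).indicator (fun x => ((‖u x‖ ^ q : ℝ) : ℂ)) x := by
      intro x
      by_cases hx : x ∈ (s : Set V)
      · simp only [f, indicator_of_mem hx, hφ]
      · simp [f, indicator_of_notMem hx]
    simp only [h1]
    rw [integral_indicator MeasurableSet.of_discrete, integral_complex_ofReal, ← enorm_norm,
      Complex.norm_real, enorm_norm,
      Real.enorm_eq_ofReal (integral_nonneg fun x => by positivity),
      ofReal_integral_eq_lintegral_ofReal _ (ae_of_all _ fun x => by positivity)]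
    · refine lintegral_congr fun x => ?_
      rw [← ofReal_norm, ENNReal.ofReal_rpow_of_nonneg (norm_nonneg _) hq0.le]
    · rw [← IntegrableOn, ← integrable_indicator_iff MeasurableSet.of_discrete]
      rw [← integrableOn_iff_integrable_of_support_subset support_indicator_subset,
        ← biUnion_of_singleton (s : Set V), integrableOn_finite_biUnion s.finite_toSet]
      exact fun x _ => integrableOn_singleton (hx := (hμ x).lt_top)
  have hmain : X ≤ G ^ (1 / q) * (C * X) ^ (1 / p) := by
    calc X = ‖∫ y, g y * kernelOp μ K f y ∂μ‖ₑ := by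
          rw [← integral_kernelOp_mul hμ hfs hg]; exact hXint
      _ ≤ ∫⁻ y, ‖g y‖ₑ * ‖kernelOp μ K f y‖ₑ ∂μ := by
          refine (enorm_integral_le_lintegral_enorm _).trans_eq ?_
          simp only [enorm_mul]
      _ ≤ G ^ (1 / q) * (∫⁻ y, ‖kernelOp μ K f y‖ₑ ^ p ∂μ) ^ (1 / p) :=
          ENNReal.lintegral_mul_le_Lp_mul_Lq μ hpq.symm Measurable.of_discrete.aemeasurable
            Measurable.of_discrete.aemeasurable
      _ ≤ G ^ (1 / q) * (C * X) ^ (1 / p) := by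
          gcongr
          rw [← hfX]
          exact h f hfs
  rcases eq_or_ne X 0 with hX0 | hX0
  · rw [hX0]; exact zero_le
  have hsplit : X = X ^ (1 / q) * X ^ (1 / p) := by
    rw [← ENNReal.rpow_add _ _ hX0 hXt, add_comm, one_div, one_div, hpq.inv_add_inv_eq_one,
      ENNReal.rpow_one]
  have hXp0 : X ^ (1 / p) ≠ 0 := by simp [ENNReal.rpow_eq_zero_iff, hX0, hXt]
  have hXpt : X ^ (1 / p) ≠ ∞ := ENNReal.rpow_ne_top_of_nonneg (by positivity) hXt
  have h2 : X ^ (1 / q) ≤ G ^ (1 / q) * C ^ (1 / p) := by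
    refine (ENNReal.mul_le_mul_iff_left hXp0 hXpt).1 ?_
    rw [← hsplit, mul_assoc, ← ENNReal.mul_rpow_of_nonneg _ _ (by positivity)]
    exact hmain
  have h3 := ENNReal.rpow_le_rpow h2 hq0.le
  rw [ENNReal.mul_rpow_of_nonneg _ _ hq0.le, ← ENNReal.rpow_mul, ← ENNReal.rpow_mul,
    ← ENNReal.rpow_mul, one_div_mul_cancel hq0.ne', ENNReal.rpow_one, ENNReal.rpow_one] at h3
  rw [mul_comm, div_eq_mul_one_div q p, mul_comm q]
  exact h3

/-- A kernel that is bounded on `Lᵖ` is in the dual Lebesgue space in its second variable. -/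
theorem IsStrongType.lintegral_kernel_lt_top (hμ : ∀ x, μ {x} ≠ ∞) (hμ0 : ∀ x, μ {x} ≠ 0)
    {p q : ℝ} (hpq : p.HolderConjugate q) {C : ℝ≥0∞} (hC : C ≠ ∞) (h : IsStrongType μ K p C)
    (x : V) : ∫⁻ y, ‖K x y‖ₑ ^ q ∂μ < ∞ := by
  have hp0 := hpq.pos
  have hq0 := hpq.symm.pos
  -- The transposed operator sends the indicator of `x` to `μ {x}` times the row `K x ·`.
  have h1 := h.transpose hμ hpq (({x} : Set V).indicator 1)
    ((finite_singleton x).subset support_indicator_subset)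
  simp only [enorm_kernelOp_indicator_singleton (K := fun x y => K y x) hμ,
    ENNReal.mul_rpow_of_nonneg _ _ hq0.le] at h1
  rw [lintegral_const_mul _ Measurable.of_discrete] at h1
  have h2 : ∫⁻ z, ‖({x} : Set V).indicator (1 : V → ℂ) z‖ₑ ^ q ∂μ = μ {x} := by
    rw [← lintegral_indicator_one MeasurableSet.of_discrete]
    refine lintegral_congr fun z => ?_
    by_cases hz : z ∈ ({x} : Set V) <;> simp [hz, hq0]
  rw [h2] at h1
  refine ENNReal.lt_top_of_mul_ne_top_right (a := μ {x} ^ q) (ne_top_of_le_ne_top ?_ h1) ?_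
  · exact ENNReal.mul_ne_top (ENNReal.rpow_ne_top_of_nonneg (by positivity) hC) (hμ x)
  · exact (ENNReal.rpow_pos (pos_iff_ne_zero.2 (hμ0 x)) (hμ x)).ne'

theorem IsStrongType.integrable_kernel_mul (hμ : ∀ x, μ {x} ≠ ∞) (hμ0 : ∀ x, μ {x} ≠ 0)
    {p q : ℝ} (hpq : p.HolderConjugate q) {C : ℝ≥0∞} (hC : C ≠ ∞) (h : IsStrongType μ K p C)
    {g : V → ℂ} (hg : ∫⁻ y, ‖g y‖ₑ ^ p ∂μ < ∞) (x : V) :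
    Integrable (fun y => K x y * g y) μ := by
  have hp0 := hpq.pos
  have hq0 := hpq.symm.pos
  refine ⟨Measurable.of_discrete.aestronglyMeasurable, ?_⟩
  have h1 := ENNReal.lintegral_mul_le_Lp_mul_Lq μ hpq.symm (f := fun y => ‖K x y‖ₑ)
    (g := fun y => ‖g y‖ₑ) Measurable.of_discrete.aemeasurable Measurable.of_discrete.aemeasurable
  simp only [HasFiniteIntegral, enorm_mul]
  refine h1.trans_lt (ENNReal.mul_lt_top ?_ ?_)
  · exact ENNReal.rpow_lt_top_of_nonneg (by positivity)
      (h.lintegral_kernel_lt_top hμ hμ0 hpq hC x).ne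
  · exact ENNReal.rpow_lt_top_of_nonneg (by positivity) hg.ne

end StrongType

/-! ### Extension to Lebesgue spaces, and the kernel of `A` on `L²`. -/

section Extension

variable {V : Type*} [MeasurableSpace V] {μ : Measure V} {K : V → V → ℂ}

theorem kernelOp_congr_ae {f g : V → ℂ} (h : f =ᵐ[μ] g) (x : V) :
    kernelOp μ K f x = kernelOp μ K g x := by
  refine integral_congr_ae ?_
  filter_upwards [h] with y hy
  rw [hy]

theorem lintegral_enorm_sq_eq (G : Lp ℂ 2 μ) : ∫⁻ x, ‖G x‖ₑ ^ 2 ∂μ = ‖G‖ₑ ^ 2 := by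
  have h := eLpNorm_nnreal_pow_eq_lintegral (f := G) (μ := μ) (p := 2) two_ne_zero
  rw [Lp.enorm_def]
  simpa using h.symm

variable [DiscreteMeasurableSpace V]

/-- The domain is abstract, with a linear map `ι` into a Lebesgue space, so that the statement
serves both `Lᵖ` and `H¹` with its own norm. -/
theorem exists_continuousLinearMap_kernelOp {E : Type*} [SeminormedAddCommGroup E]
    [NormedSpace ℂ E] {r p : ℝ≥0∞} [Fact (1 ≤ r)] [Fact (1 ≤ p)] (ι : E →ₗ[ℂ] Lp ℂ r μ)
    (hi : ∀ g x, Integrable (fun y => K x y * ι g y) μ) (C : ℝ)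
    (hC : ∀ g, eLpNorm (kernelOp μ K (ι g)) p μ ≤ ENNReal.ofReal (C * ‖g‖)) :
    ∃ S : E →L[ℂ] Lp ℂ p μ, ∀ g, S g =ᵐ[μ] kernelOp μ K (ι g) := by
  have hmem : ∀ g, MemLp (kernelOp μ K (ι g)) p μ := fun g =>
    ⟨Measurable.of_discrete.aestronglyMeasurable, (hC g).trans_lt ENNReal.ofReal_lt_top⟩
  let S₀ : E →ₗ[ℂ] Lp ℂ p μ :=
    { toFun := fun g => (hmem g).toLp
      map_add' := fun g₁ g₂ => by
        rw [← MemLp.toLp_add]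
        refine MemLp.toLp_congr _ _ (ae_of_all _ fun x => ?_)
        rw [map_add, kernelOp_congr_ae (Lp.coeFn_add _ _)]
        simp only [kernelOp, Pi.add_apply, mul_add]
        exact integral_add (hi g₁ x) (hi g₂ x)
      map_smul' := fun c g => by
        rw [RingHom.id_apply, ← MemLp.toLp_const_smul]
        refine MemLp.toLp_congr _ _ (ae_of_all _ fun x => ?_)
        rw [map_smul, kernelOp_congr_ae (Lp.coeFn_smul _ _)]
        simp only [kernelOp, Pi.smul_apply, smul_eq_mul, mul_left_comm _ c]
        exact integral_const_mul _ _ }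
  refine ⟨S₀.mkContinuous (max C 0) fun g => ?_, fun g => (hmem g).coeFn_toLp⟩
  change ‖(hmem g).toLp‖ ≤ _
  rw [Lp.norm_toLp]
  refine ENNReal.toReal_le_of_le_ofReal (by positivity) ((hC g).trans ?_)
  gcongr
  exact le_max_left _ _

theorem IsStrongType.exists_extension [Countable V] [SFinite μ] (hμ : ∀ x, μ {x} ≠ ∞)
    (hμ0 : ∀ x, μ {x} ≠ 0) {p : ℝ≥0∞} [Fact (1 ≤ p)] (hp : 1 < p) (hp' : p ≠ ∞) {C : ℝ≥0∞}
    (hC : C ≠ ∞) (h : IsStrongType μ K p.toReal C) :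
    ∃ S : Lp ℂ p μ →L[ℂ] Lp ℂ p μ, ∀ g, S g =ᵐ[μ] kernelOp μ K g := by
  have hp1 : 1 < p.toReal := by
    rw [← ENNReal.toReal_one]
    exact (ENNReal.toReal_lt_toReal ENNReal.one_ne_top hp').2 hp
  have hp0 : p ≠ 0 := (zero_lt_one.trans hp).ne'
  have hi : ∀ (g : Lp ℂ p μ) x, Integrable (fun y => K x y * g y) μ := fun g x =>
    h.integrable_kernel_mul hμ hμ0 (Real.HolderConjugate.conjExponent hp1) hC
      (lintegral_rpow_enorm_lt_top_of_eLpNorm_lt_top hp0 hp' (Lp.eLpNorm_lt_top g)) x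
  have hb : ∀ g : Lp ℂ p μ, eLpNorm (kernelOp μ K g) p μ ≤
      ENNReal.ofReal ((C ^ (1 / p.toReal)).toReal * ‖g‖) := by
    intro g
    rw [ENNReal.ofReal_mul ENNReal.toReal_nonneg, ENNReal.ofReal_toReal
      (ENNReal.rpow_ne_top_of_nonneg (by positivity) hC), ofReal_norm, Lp.enorm_def,
      eLpNorm_eq_lintegral_rpow_enorm_toReal hp0 hp',
      eLpNorm_eq_lintegral_rpow_enorm_toReal hp0 hp',
      ← ENNReal.mul_rpow_of_nonneg _ _ (by positivity)]
    gcongr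
    exact h.lintegral_kernelOp_rpow_le (by linarith) (hi g)
  exact exists_continuousLinearMap_kernelOp (E := Lp ℂ p μ) (r := p) LinearMap.id hi _ hb

/-- The kernel represents `A` on all of `L²`, pointwise. -/
theorem apply_eq_kernelOp [Countable V] (hμ : ∀ x, μ {x} ≠ ∞) (hμ0 : ∀ x, μ {x} ≠ 0)
    {A : Lp ℂ 2 μ →L[ℂ] Lp ℂ 2 μ}
    (hK : ∀ f : Lp ℂ 2 μ, (Function.support f).Finite → A f =ᵐ[μ] kernelOp μ K f) (x : V)
    (f : Lp ℂ 2 μ) :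
    Integrable (fun y => K x y * f y) μ ∧ A f x = kernelOp μ K f x := by
  have hr : ∀ x, μ.real {x} ≠ 0 := fun x => (ENNReal.toReal_pos (hμ0 x) (hμ x)).ne'
  have hall : ∀ {g g' : V → ℂ}, g =ᵐ[μ] g' → ∀ x, g x = g' x := fun h x =>
    ae_iff_of_countable.1 h x (hμ0 x)
  let δ : V → Lp ℂ 2 μ := fun y =>
    indicatorConstLp 2 (MeasurableSet.of_discrete (s := {y})) (hμ y) 1
  have hδ : ∀ y (g : Lp ℂ 2 μ), inner ℂ (δ y) g = μ.real {y} • g y := by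
    intro y g
    rw [L2.inner_indicatorConstLp_one, integral_singleton]
  -- Evaluation of `A g` at the vertex `x` is a bounded functional on `L²`. The function `w`
  -- represents it up to the mass of `x`; testing on point masses identifies its conjugate with that
  -- mass times the row `K x ·`.
  let w := A.adjoint (δ x)
  have hw : ∀ g : Lp ℂ 2 μ, μ.real {x} • A g x = inner ℂ w g := by
    intro g
    rw [← hδ, ContinuousLinearMap.adjoint_inner_left]
  have hKw : ∀ y, μ.real {x} • K x y = starRingEnd ℂ (w y) := by
    intro y
    have h1 := hall (indicatorConstLp_coeFn (p := 2) (hs := MeasurableSet.of_discrete (s := {y}))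
      (hμs := hμ y) (c := (1 : ℂ)))
    have h2 := hw (δ y)
    have h3 : Function.support (δ y) ⊆ {y} := by
      rw [show (δ y : V → ℂ) = _ from funext h1]
      exact support_indicator_subset
    rw [hall (hK (δ y) ((finite_singleton y).subset h3)) x,
      show (δ y : V → ℂ) = ({y} : Set V).indicator 1 from funext h1] at h2
    rw [kernelOp_indicator_singleton, ← inner_conj_symm, hδ, smul_comm] at h2
    have h4 : starRingEnd ℂ (μ.real {y} • w y) = μ.real {y} • starRingEnd ℂ (w y) := by
      simp [Complex.real_smul]
    rw [h4] at h2
    exact smul_right_injective ℂ (hr y) h2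
  have hK' : ∀ y, K x y * f y = (μ.real {x})⁻¹ • inner ℂ (w y) (f y) := by
    intro y
    rw [RCLike.inner_apply, ← hKw, mul_comm (f y), smul_mul_assoc, inv_smul_smul₀ (hr x)]
  rw [kernelOp, funext hK']
  refine ⟨(L2.integrable_inner w f).smul (μ.real {x})⁻¹, ?_⟩
  rw [integral_smul, ← L2.inner_def, ← hw, inv_smul_smul₀ (hr x)]

theorem isStrongTypeTwo_of_apply_eq [Countable V] (hμ : ∀ x, μ {x} ≠ ∞) (hμ0 : ∀ x, μ {x} ≠ 0)
    {A : Lp ℂ 2 μ →L[ℂ] Lp ℂ 2 μ}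
    (hK : ∀ f : Lp ℂ 2 μ, (Function.support f).Finite → A f =ᵐ[μ] kernelOp μ K f) :
    IsStrongTypeTwo μ K (‖A‖ₑ ^ 2) := by
  intro f hf
  have hmem : MemLp f 2 μ := by
    refine (memLp_two_iff_integrable_sq_norm Measurable.of_discrete.aestronglyMeasurable).2 ?_
    have : (Function.support fun x => ‖f x‖ ^ 2) = Function.support f := by
      ext x; simp
    rw [← integrableOn_iff_integrable_of_support_subset this.subset,
      ← biUnion_of_singleton (Function.support f), integrableOn_finite_biUnion hf]
    exact fun x _ => integrableOn_singleton (hx := (hμ x).lt_top)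
  have hf' : (hmem.toLp : V → ℂ) = f :=
    funext fun x => ae_iff_of_countable.1 hmem.coeFn_toLp x (hμ0 x)
  have h1 := hK hmem.toLp (by rwa [hf'])
  rw [hf'] at h1
  have h2 : ∫⁻ x, ‖kernelOp μ K f x‖ₑ ^ 2 ∂μ = ‖A hmem.toLp‖ₑ ^ 2 := by
    rw [← lintegral_enorm_sq_eq]
    refine lintegral_congr_ae ?_
    filter_upwards [h1] with x hx
    rw [hx]
  have h3 : ∫⁻ x, ‖f x‖ₑ ^ 2 ∂μ = ‖hmem.toLp‖ₑ ^ 2 := by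
    rw [← lintegral_enorm_sq_eq, hf']
  rw [h2, h3, ← mul_pow]
  gcongr
  exact A.le_opENorm _

end Extension

/-! ### Boundedness from the Hardy space to `L¹`. -/

theorem ENNReal.le_mul_sq_add_inv (t : ℝ≥0∞) {s : ℝ≥0∞} (hs : s ≠ 0) (hs' : s ≠ ∞) :
    t ≤ s * t ^ 2 + s⁻¹ := by
  rcases le_total 1 (s * t) with h | h
  · calc t = 1 * t := (one_mul t).symm
      _ ≤ s * t * t := by gcongr
      _ = s * t ^ 2 := by ring
      _ ≤ _ := le_self_add
  · refine le_trans ?_ le_add_self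
    rw [← one_div, ENNReal.le_div_iff_mul_le (.inl hs) (.inl hs'), mul_comm]
    exact h

section kernelOp

variable {V : Type*} [MeasurableSpace V] [DiscreteMeasurableSpace V] {μ : Measure V}
  {K : V → V → ℂ}

/-- The local estimate for both endpoints. In place of Cauchy–Schwarz, `t ≤ t² / M + M` is
integrated over `E`. -/
theorem IsStrongTypeTwo.setLIntegral_le {N : ℝ≥0∞} (hN : IsStrongTypeTwo μ K N) {f : V → ℂ}
    (hf : (Function.support f).Finite) {M : ℝ≥0∞} (hM0 : M ≠ 0) (hM : M ≠ ∞)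
    (hfM : ∀ x, ‖f x‖ₑ ≤ M) {R E : Set V} (hR : Function.support f ⊆ R) :
    ∫⁻ x in E, ‖kernelOp μ K f x‖ₑ ∂μ ≤ M * (N * μ R + μ E) := by
  have h1 : ∫⁻ x, ‖f x‖ₑ ^ 2 ∂μ ≤ M ^ 2 * μ R := by
    rw [← lintegral_indicator_const MeasurableSet.of_discrete]
    refine lintegral_mono fun x => ?_
    by_cases hx : x ∈ R
    · rw [indicator_of_mem hx]
      gcongr
      exact hfM x
    · have : f x = 0 := by
        by_contra h
        exact hx (hR h)
      simp [this]
  calc ∫⁻ x in E, ‖kernelOp μ K f x‖ₑ ∂μ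
      ≤ ∫⁻ x in E, (M⁻¹ * ‖kernelOp μ K f x‖ₑ ^ 2 + M) ∂μ := by
        refine lintegral_mono fun x => ?_
        have := ENNReal.le_mul_sq_add_inv ‖kernelOp μ K f x‖ₑ (ENNReal.inv_ne_zero.2 hM)
          (ENNReal.inv_ne_top.2 hM0)
        rwa [inv_inv] at this
    _ = M⁻¹ * ∫⁻ x in E, ‖kernelOp μ K f x‖ₑ ^ 2 ∂μ + M * μ E := by
        rw [lintegral_add_left Measurable.of_discrete, lintegral_const_mul _ Measurable.of_discrete,
          setLIntegral_const]
    _ ≤ M⁻¹ * (N * (M ^ 2 * μ R)) + M * μ E := by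
        gcongr
        exact (setLIntegral_le_lintegral _ _).trans ((hN f hf).trans (by gcongr))
    _ = M⁻¹ * M * (M * (N * μ R)) + M * μ E := by ring
    _ = _ := by rw [ENNReal.inv_mul_cancel hM0 hM]; ring

/-- Integration against the bounded function `K x`, as a continuous functional on `L¹`. -/
theorem exists_continuousLinearMap_integral (x : V) {B : ℝ} (hB : ∀ y, ‖K x y‖ ≤ B) :
    ∃ φ : Lp ℂ 1 μ →L[ℂ] ℂ, ∀ g : Lp ℂ 1 μ, φ g = kernelOp μ K g x := by
  have hi : ∀ g : Lp ℂ 1 μ, Integrable (fun y => K x y * g y) μ := fun g =>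
    (L1.integrable_coeFn g).bdd_mul Measurable.of_discrete.aestronglyMeasurable (ae_of_all _ hB)
  refine ⟨LinearMap.mkContinuous
    { toFun := fun g => kernelOp μ K g x
      map_add' := fun g₁ g₂ => by
        rw [kernelOp_congr_ae (Lp.coeFn_add _ _)]
        simp only [kernelOp, Pi.add_apply, mul_add]
        exact integral_add (hi g₁) (hi g₂)
      map_smul' := fun c g => by
        rw [kernelOp_congr_ae (Lp.coeFn_smul _ _)]
        simp only [kernelOp, Pi.smul_apply, smul_eq_mul, mul_left_comm _ c, RingHom.id_apply]
        exact integral_const_mul _ _ } B fun g => ?_, fun g => rfl⟩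
  change ‖∫ y, K x y * g y ∂μ‖ ≤ _
  refine (norm_integral_le_integral_norm _).trans ?_
  rw [L1.norm_eq_integral_norm, ← integral_const_mul]
  refine integral_mono (hi g).norm ((L1.integrable_coeFn g).norm.const_mul B) fun y => ?_
  dsimp only
  rw [norm_mul]
  gcongr
  exact hB y

end kernelOp

section Hardy

variable {V : Type*} [MeasurableSpace V] [DiscreteMeasurableSpace V] {T : TreeAtInfinity V}
  {m : V → ℝ}

theorem TreeAtInfinity.IsFlow.forall_of_ae (hm : T.IsFlow m) (hd : T.IsLocallyDoubling m)
    {P : V → Prop} (h : ∀ᵐ x ∂(vertexMeasure m), P x) (x : V) : P x := by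
  have := hm.countable hd
  exact ae_iff_of_countable.1 h x (hm.measure_singleton_ne_zero x)

/-- On the enlargement the `L²` bound applies; off it the cancellation of the atom and the Hörmander
condition do. An atom on a singleton is zero. -/
theorem lintegral_kernelOp_atom_le (hm : T.IsFlow m) (hd : T.IsLocallyDoubling m) {β : ℝ}
    {K : V → V → ℂ} {N : ℝ≥0∞} (hN : IsStrongTypeTwo (vertexMeasure m) K N)
    {a : Lp ℂ 1 (vertexMeasure m)} (ha : IsHardyAtom T m β a) :
    ∫⁻ x, ‖kernelOp (vertexMeasure m) K a x‖ₑ ∂(vertexMeasure m) ≤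
      N + 3 + hormanderConst T m β K := by
  have := hm.countable hd
  have hfin := vertexMeasure_singleton_ne_top m
  have : SFinite (vertexMeasure m) := by unfold vertexMeasure; infer_instance
  obtain ⟨R, hR, hsupp, hbd, hint⟩ := ha
  have hsupp' : Function.support a ⊆ R := fun x hx => by
    by_contra h
    exact hx (hm.forall_of_ae hd hsupp x h)
  rw [← integral_indicator MeasurableSet.of_discrete, indicator_eq_self.2 hsupp'] at hint
  rw [eLpNorm_exponent_top] at hbd
  have hle : ∀ x, ‖a x‖ₑ ≤ (vertexMeasure m R)⁻¹ := fun x =>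
    (hm.forall_of_ae hd (enorm_ae_le_eLpNormEssSup a _) x).trans hbd
  rcases hR with ⟨x, rfl⟩ | ⟨x, p, q, hpq, rfl⟩
  · have h0 : (a : V → ℂ) = 0 := by
      funext y
      by_contra hy
      obtain rfl : y = x := hsupp' hy
      rw [← indicator_eq_self.2 hsupp', integral_indicator MeasurableSet.of_discrete,
        integral_singleton, smul_eq_zero] at hint
      rcases hint with h | h
      · exact (ENNReal.toReal_pos (hm.measure_singleton_ne_zero y) (hfin y)).ne' h
      · exact hy h
    simp [h0, kernelOp]
  · set R := T.trapezoid x p q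
    obtain ⟨hp0, hpq2, -⟩ := admissibleParams_iff.1 hpq
    have hRfin : R.Finite := hm.finite_trapezoid hd x p q
    have hR0 : vertexMeasure m R ≠ 0 := by
      rw [hm.measure_trapezoid hd]
      refine mul_ne_zero (by exact_mod_cast (by omega : q - p ≠ 0)) ?_
      simpa using hm.1 x
    have hRt : vertexMeasure m R ≠ ∞ := by
      rw [hm.measure_trapezoid hd]
      finiteness
    have hE := hm.measure_enlargement_le hd x hpq2
    have h1 := hN.setLIntegral_le (hRfin.subset hsupp') (ENNReal.inv_ne_zero.2 hRt)
      (ENNReal.inv_ne_top.2 hR0) hle hsupp' (E := T.enlargement x p q)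
    have h2 := lintegral_kernelOp_le hfin hRfin
      (fun y hy z hz => T.lintegral_le_hormanderConst (m := m) (K := K) hpq hy hz) hsupp' hint
    have h3 : ∫⁻ x, ‖a x‖ₑ ∂(vertexMeasure m) ≤ 1 := by
      rw [lintegral_enorm_eq_setLIntegral hsupp']
      refine (lintegral_mono fun x => hle x).trans ?_
      rw [setLIntegral_const, ENNReal.inv_mul_cancel hR0 hRt]
    rw [← lintegral_add_compl _ (MeasurableSet.of_discrete (s := T.enlargement x p q))]
    refine add_le_add (h1.trans ?_) (h2.trans (mul_le_of_le_one_right' h3))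
    calc (vertexMeasure m R)⁻¹ * (N * vertexMeasure m R + vertexMeasure m (T.enlargement x p q))
        ≤ (vertexMeasure m R)⁻¹ * (N * vertexMeasure m R + 3 * vertexMeasure m R) := by gcongr
      _ = (vertexMeasure m R)⁻¹ * vertexMeasure m R * (N + 3) := by ring
      _ = N + 3 := by rw [ENNReal.inv_mul_cancel hR0 hRt, one_mul]

/-- A uniform bound on atoms does not by itself pass to infinite sums. Here weak type `(1, 1)`
bounds each row of `K`, so evaluating the integral at `x` is continuous on `L¹` and commutes with
the atomic series. -/
theorem exists_extension_hardySpace (hm : T.IsFlow m) (hd : T.IsLocallyDoubling m) {β : ℝ}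
    (hβ : 12 ≤ β) {K : V → V → ℂ} {N : ℝ≥0∞} (hN : IsStrongTypeTwo (vertexMeasure m) K N)
    (hN' : N ≠ ∞) (hK : hormanderConst T m β K < ∞) :
    ∃ S : HardySpace T m β →L[ℂ] Lp ℂ 1 (vertexMeasure m),
      ∀ g, S g =ᵐ[vertexMeasure m] kernelOp (vertexMeasure m) K (HardySpace.toL1 g) := by
  have := hm.countable hd
  have hfin := vertexMeasure_singleton_ne_top m
  have h0 := hm.measure_singleton_ne_zero
  obtain ⟨W, hW, hweak⟩ := hm.isWeakTypeOne hd hβ hN hN' hK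
  have hbd : ∀ x y, ‖K x y‖ ≤ (W / vertexMeasure m {x}).toReal := by
    intro x y
    rw [← toReal_enorm]
    exact ENNReal.toReal_mono (ENNReal.div_ne_top hW (h0 x)) (hweak.enorm_kernel_le hfin h0 x y)
  set B : ℝ≥0∞ := N + 3 + hormanderConst T m β K with hB
  have hBt : B ≠ ∞ := by finiteness
  have hB0 : 0 < B.toReal := ENNReal.toReal_pos (by simp [hB]) hBt
  refine exists_continuousLinearMap_kernelOp (E := HardySpace T m β) (r := 1) HardySpace.toL1
    (fun g x => (L1.integrable_coeFn _).bdd_mul Measurable.of_discrete.aestronglyMeasurable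
      (ae_of_all _ (hbd x))) B.toReal fun g => ?_
  have key : ∀ c a, IsAtomicDecomposition T m β (HardySpace.toL1 g) c a →
      eLpNorm (kernelOp (vertexMeasure m) K (HardySpace.toL1 g)) 1 (vertexMeasure m) ≤
        B * ENNReal.ofReal (∑' j, ‖c j‖) := by
    rintro c a ⟨ha, hc, hs⟩
    have hpt : ∀ x, ‖kernelOp (vertexMeasure m) K (HardySpace.toL1 g) x‖ₑ ≤
        ∑' j, ‖c j‖ₑ * ‖kernelOp (vertexMeasure m) K (a j) x‖ₑ := by
      intro x
      obtain ⟨φ, hφ⟩ := exists_continuousLinearMap_integral (μ := vertexMeasure m) x (hbd x)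
      rw [← hφ, ← (hs.mapL φ).tsum_eq]
      refine enorm_tsum_le_tsum_enorm.trans_eq ?_
      congr! 2 with j
      rw [map_smul, enorm_smul, hφ]
    rw [eLpNorm_one_eq_lintegral_enorm]
    calc _ ≤ ∫⁻ x, ∑' j, ‖c j‖ₑ * ‖kernelOp (vertexMeasure m) K (a j) x‖ₑ ∂(vertexMeasure m) :=
          lintegral_mono hpt
      _ = ∑' j, ‖c j‖ₑ * ∫⁻ x, ‖kernelOp (vertexMeasure m) K (a j) x‖ₑ ∂(vertexMeasure m) := by
          rw [lintegral_tsum fun j => Measurable.of_discrete.aemeasurable]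
          congr! 2 with j
          exact lintegral_const_mul _ Measurable.of_discrete
      _ ≤ ∑' j, ‖c j‖ₑ * B := by
          gcongr with j
          exact lintegral_kernelOp_atom_le hm hd hN (ha j)
      _ = _ := by
          rw [ENNReal.tsum_mul_right, mul_comm,
            ENNReal.ofReal_tsum_of_nonneg (fun _ => norm_nonneg _) hc]
          simp only [ofReal_norm]
  obtain ⟨c, a, hca⟩ := HardySpace.exists_decomposition g
  have htop : eLpNorm (kernelOp (vertexMeasure m) K (HardySpace.toL1 g)) 1 (vertexMeasure m) ≠ ∞ :=
    ne_top_of_le_ne_top (by finiteness) (key c a hca)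
  rw [← ENNReal.ofReal_toReal htop]
  refine ENNReal.ofReal_le_ofReal ?_
  rw [← div_le_iff₀' hB0]
  refine HardySpace.le_norm fun c a hca => ?_
  rw [div_le_iff₀' hB0]
  have hnn : 0 ≤ ∑' j, ‖c j‖ := tsum_nonneg fun _ => norm_nonneg _
  have h := ENNReal.toReal_mono (by finiteness) (key c a hca)
  rwa [ENNReal.toReal_mul, ENNReal.toReal_ofReal hnn] at h

end Hardy

/-! ### Boundedness from `L^∞` to `BMO`. -/

section BMO

variable {V : Type*} [MeasurableSpace V] [DiscreteMeasurableSpace V] {T : TreeAtInfinity V}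
  {m : V → ℝ}

theorem meanOscillation_le_of_const {R : Set V} (hR : R.Finite) (hR0 : vertexMeasure m R ≠ 0)
    (u : V → ℂ) (c : ℂ) :
    meanOscillation m R u ≤ 2 * ⨍⁻ x in R, ‖u x - c‖ₑ ∂(vertexMeasure m) := by
  have hRt : vertexMeasure m R ≠ ∞ := by
    rw [← biUnion_of_singleton R]
    exact (measure_biUnion_lt_top hR fun x _ => (vertexMeasure_singleton_ne_top m x).lt_top).ne
  have hi : Integrable u ((vertexMeasure m).restrict R) := by
    rw [← IntegrableOn, ← biUnion_of_singleton R, integrableOn_finite_biUnion hR]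
    exact fun x _ => integrableOn_singleton (hx := (vertexMeasure_singleton_ne_top m x).lt_top)
  unfold meanOscillation laverage average
  set ν := ((vertexMeasure m).restrict R univ)⁻¹ • (vertexMeasure m).restrict R
  have hν : IsProbabilityMeasure ν :=
    ⟨by simp [ν, ENNReal.inv_mul_cancel hR0 hRt]⟩
  have hiν : Integrable u ν := hi.smul_measure (by simpa using hR0)
  have h1 : ‖c - ∫ y, u y ∂ν‖ₑ ≤ ∫⁻ x, ‖u x - c‖ₑ ∂ν := by
    have h2 : c - ∫ y, u y ∂ν = ∫ y, (c - u y) ∂ν := by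
      rw [integral_sub (integrable_const c) hiν]
      simp
    rw [h2]
    refine (enorm_integral_le_lintegral_enorm _).trans_eq ?_
    simp only [enorm_sub_rev]
  calc ∫⁻ x, ‖u x - ∫ y, u y ∂ν‖ₑ ∂ν ≤ ∫⁻ x, (‖u x - c‖ₑ + ‖c - ∫ y, u y ∂ν‖ₑ) ∂ν := by
        refine lintegral_mono fun x => ?_
        rw [← sub_add_sub_cancel (u x) c]
        exact enorm_add_le _ _
    _ = ∫⁻ x, ‖u x - c‖ₑ ∂ν + ‖c - ∫ y, u y ∂ν‖ₑ := by
        rw [lintegral_add_left Measurable.of_discrete]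
        simp
    _ ≤ _ := by rw [two_mul]; gcongr

theorem TreeAtInfinity.IsFlow.finite_enlargement (hm : T.IsFlow m) (hd : T.IsLocallyDoubling m)
    (x : V) (a b : ℕ) : (T.enlargement x a b).Finite :=
  ((Finset.finite_toSet _).biUnion fun n _ => hm.finite_descendants hd x n).subset
    (T.enlargement_subset x a b)

/-- Some ray trapezoid contains both `x` and `z`. Its enlargement is finite, and outside it the
Hörmander condition for the transposed kernel gives integrability. -/
theorem integrable_kernel_sub (hm : T.IsFlow m) (hd : T.IsLocallyDoubling m) {β : ℝ}
    (hβ : 12 ≤ β) {K : V → V → ℂ} (hK : hormanderConst T m β (fun x y => K y x) < ∞) (x z : V) :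
    Integrable (fun y => K x y - K z y) (vertexMeasure m) := by
  obtain ⟨n₁, h₁⟩ := T.exists_mem_trapezoid_ray x
  obtain ⟨n₂, h₂⟩ := T.exists_mem_trapezoid_ray z
  let k := n₁ + n₂ + 1
  rw [← integrableOn_univ, ← union_compl_self (T.enlargement (T.ray (2 * k)) k (12 * k))]
  refine IntegrableOn.union ?_ ⟨Measurable.of_discrete.aestronglyMeasurable, ?_⟩
  · rw [← biUnion_of_singleton (T.enlargement (T.ray (2 * k)) k (12 * k)),
      integrableOn_finite_biUnion (hm.finite_enlargement hd _ _ _)]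
    exact fun x _ => integrableOn_singleton (hx := (vertexMeasure_singleton_ne_top m x).lt_top)
  · exact (T.lintegral_le_hormanderConst (m := m) (K := fun x y => K y x)
      (TreeAtInfinity.admissibleParams_ray hβ (k := k) (by omega)) (h₁ k (by omega))
      (h₂ k (by omega))).trans_lt hK

/-- On a trapezoid, up to a constant, the function splits into the image of `f` restricted to the
enlargement, controlled by `L²`, and `∫ (K x y - K z y) f y` over its complement, controlled by the
Hörmander condition. -/
theorem bmoENorm_le_of_bounded (hm : T.IsFlow m) (hd : T.IsLocallyDoubling m) {β : ℝ}
    (hβ : 12 ≤ β) {K : V → V → ℂ} {N : ℝ≥0∞} (hN : IsStrongTypeTwo (vertexMeasure m) K N)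
    (hK : hormanderConst T m β (fun x y => K y x) < ∞) (o : V) {f : V → ℂ} {M : ℝ≥0∞}
    (hM0 : M ≠ 0) (hM : M ≠ ∞) (hf : ∀ x, ‖f x‖ₑ ≤ M) :
    bmoENorm T m β (fun x => ∫ y, (K x y - K o y) * f y ∂(vertexMeasure m)) ≤
      2 * (3 * N + 1 + hormanderConst T m β (fun x y => K y x)) * M := by
  set μ := vertexMeasure m
  set H := hormanderConst T m β (fun x y => K y x)
  have hfin := vertexMeasure_singleton_ne_top m
  have hi : ∀ x z, Integrable (fun y => (K x y - K z y) * f y) μ := fun x z =>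
    (integrable_kernel_sub hm hd hβ hK x z).mul_bdd (c := M.toReal)
      Measurable.of_discrete.aestronglyMeasurable (ae_of_all _ fun y => by
        rw [← toReal_enorm]; exact ENNReal.toReal_mono hM (hf y))
  set u : V → ℂ := fun x => ∫ y, (K x y - K o y) * f y ∂μ with hu
  refine iSup₂_le fun R hR => ?_
  rcases hR with ⟨x, rfl⟩ | ⟨x₀, a, b, hab, rfl⟩
  · refine (meanOscillation_le_of_const (finite_singleton x) (hm.measure_singleton_ne_zero x) u
      (u x)).trans ?_
    rw [setLAverage_eq, lintegral_singleton]
    simp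
  obtain ⟨ha, hab2, -⟩ := admissibleParams_iff.1 hab
  set R := T.trapezoid x₀ a b
  set E := T.enlargement x₀ a b
  have hRfin : R.Finite := hm.finite_trapezoid hd x₀ a b
  have hEfin : E.Finite := hm.finite_enlargement hd x₀ a b
  have hR0 : μ R ≠ 0 := by
    rw [hm.measure_trapezoid hd]
    refine mul_ne_zero (by exact_mod_cast (by omega : b - a ≠ 0)) ?_
    simpa using hm.1 x₀
  have hRt : μ R ≠ ∞ := by
    rw [hm.measure_trapezoid hd]
    finiteness
  obtain ⟨z, hz⟩ := hm.trapezoid_nonempty hd x₀ (show a < b by omega)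
  have hfE : (Function.support (E.indicator f)).Finite := hEfin.subset support_indicator_subset
  have hKE : ∀ x, Integrable (fun y => K x y * E.indicator f y) μ := fun x =>
    integrable_of_finite_support hfin (hfE.subset fun y hy => right_ne_zero_of_mul hy)
  -- The constant subtracted is `∫ (K z y - K o y) f y` off `E` minus `∫ K o y f y` on `E`. The
  -- separate integrals of `K z y f y` and `K o y f y` off `E` need not converge.
  have hdiff : ∀ x ∈ R, ‖u x - (u z - kernelOp μ K (E.indicator f) z)‖ₑ ≤
      ‖kernelOp μ K (E.indicator f) x‖ₑ + H * M := by
    intro x hx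
    have h1 : u x - u z = ∫ y, (K x y - K z y) * f y ∂μ := by
      rw [hu]
      dsimp only
      rw [← integral_sub (hi x o) (hi z o)]
      congr! 2 with y
      ring
    have h2 : ∫ y in E, (K x y - K z y) * f y ∂μ =
        kernelOp μ K (E.indicator f) x - kernelOp μ K (E.indicator f) z := by
      rw [kernelOp, kernelOp, ← integral_sub (hKE x) (hKE z),
        ← integral_indicator MeasurableSet.of_discrete]
      congr! 2 with y
      by_cases hy : y ∈ E
      · simp only [indicator_of_mem hy]; ring
      · simp [indicator_of_notMem hy]
    have h3 : u x - (u z - kernelOp μ K (E.indicator f) z) =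
        kernelOp μ K (E.indicator f) x + ∫ y in Eᶜ, (K x y - K z y) * f y ∂μ := by
      rw [← integral_add_compl (MeasurableSet.of_discrete (s := E)) (hi x z), h2] at h1
      linear_combination h1
    rw [h3]
    refine (enorm_add_le _ _).trans ?_
    gcongr
    refine (enorm_integral_le_lintegral_enorm _).trans ?_
    calc ∫⁻ y in Eᶜ, ‖(K x y - K z y) * f y‖ₑ ∂μ ≤ ∫⁻ y in Eᶜ, ‖K x y - K z y‖ₑ * M ∂μ := by
          refine lintegral_mono fun y => ?_
          rw [enorm_mul]
          gcongr
          exact hf y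
      _ = (∫⁻ y in Eᶜ, ‖K x y - K z y‖ₑ ∂μ) * M := lintegral_mul_const _ Measurable.of_discrete
      _ ≤ H * M := by
          gcongr
          exact T.lintegral_le_hormanderConst (m := m) (K := fun x y => K y x) hab hx hz
  refine (meanOscillation_le_of_const hRfin hR0 u
    (u z - kernelOp μ K (E.indicator f) z)).trans ?_
  rw [mul_assoc]
  refine mul_le_mul_right ?_ 2
  rw [setLAverage_eq]
  refine ENNReal.div_le_of_le_mul ?_
  calc ∫⁻ x in R, ‖u x - (u z - kernelOp μ K (E.indicator f) z)‖ₑ ∂μ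
      ≤ ∫⁻ x in R, (‖kernelOp μ K (E.indicator f) x‖ₑ + H * M) ∂μ :=
        setLIntegral_mono' MeasurableSet.of_discrete hdiff
    _ = ∫⁻ x in R, ‖kernelOp μ K (E.indicator f) x‖ₑ ∂μ + H * M * μ R := by
        rw [lintegral_add_left Measurable.of_discrete, setLIntegral_const]
    _ ≤ M * (N * μ E + μ R) + H * M * μ R := by
        gcongr
        exact hN.setLIntegral_le hfE hM0 hM
          (fun x => (enorm_indicator_le_enorm_self _ _).trans (hf x)) support_indicator_subset
    _ ≤ M * (N * (3 * μ R) + μ R) + H * M * μ R := by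
        gcongr
        exact hm.measure_enlargement_le hd x₀ hab2
    _ = _ := by ring

theorem exists_extension_bmo (hm : T.IsFlow m) (hd : T.IsLocallyDoubling m) {β : ℝ}
    (hβ : 12 ≤ β) {K : V → V → ℂ} {N : ℝ≥0∞} (hN : IsStrongTypeTwo (vertexMeasure m) K N)
    (hN' : N ≠ ∞) (hK : hormanderConst T m β (fun x y => K y x) < ∞) (o : V) :
    ∃ S : Lp ℂ ∞ (vertexMeasure m) →L[ℂ] BMOFun T m β, ∀ g,
      BMOFun.toFun (S g) = fun x => ∫ y, (K x y - K o y) * g y ∂(vertexMeasure m) := by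
  set B : ℝ≥0∞ := 2 * (3 * N + 1 + hormanderConst T m β (fun x y => K y x)) with hB
  have hBt : B ≠ ∞ := by finiteness
  have hle : ∀ (g : Lp ℂ ∞ (vertexMeasure m)) x, ‖g x‖ₑ ≤ ‖g‖ₑ := by
    intro g x
    rw [Lp.enorm_def, eLpNorm_exponent_top]
    exact hm.forall_of_ae hd (enorm_ae_le_eLpNormEssSup g _) x
  have hi : ∀ (g : Lp ℂ ∞ (vertexMeasure m)) x,
      Integrable (fun y => (K x y - K o y) * g y) (vertexMeasure m) := fun g x =>
    (integrable_kernel_sub hm hd hβ hK x o).mul_bdd (c := ‖g‖)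
      Measurable.of_discrete.aestronglyMeasurable (ae_of_all _ fun y => by
        rw [← toReal_enorm, ← toReal_enorm]
        exact ENNReal.toReal_mono enorm_ne_top (hle g y))
  have hbd : ∀ g : Lp ℂ ∞ (vertexMeasure m),
      bmoENorm T m β (fun x => ∫ y, (K x y - K o y) * g y ∂(vertexMeasure m)) ≤ B * ‖g‖ₑ := by
    intro g
    rcases eq_or_ne ‖g‖ₑ 0 with h0 | h0
    · have hg : ∀ x, g x = 0 := fun x => by simpa [h0] using hle g x
      simp only [hg, mul_zero, integral_zero]
      have h := bmoENorm_smul T m β 0 0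
      rw [zero_smul, enorm_zero, zero_mul] at h
      exact (le_of_eq h).trans zero_le
    · exact bmoENorm_le_of_bounded hm hd hβ hN hK o h0 enorm_ne_top (hle g)
  let S₀ : Lp ℂ ∞ (vertexMeasure m) →ₗ[ℂ] BMOFun T m β :=
    { toFun := fun g => ⟨fun x => ∫ y, (K x y - K o y) * g y ∂(vertexMeasure m),
        (hbd g).trans_lt (by finiteness)⟩
      map_add' := fun g₁ g₂ => by
        refine Subtype.ext (funext fun x => ?_)
        change ∫ y, (K x y - K o y) * (g₁ + g₂ : Lp ℂ ∞ (vertexMeasure m)) y ∂(vertexMeasure m) =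
          ∫ y, (K x y - K o y) * g₁ y ∂(vertexMeasure m) +
            ∫ y, (K x y - K o y) * g₂ y ∂(vertexMeasure m)
        rw [← integral_add (hi g₁ x) (hi g₂ x)]
        refine integral_congr_ae ?_
        filter_upwards [Lp.coeFn_add g₁ g₂] with y hy
        rw [hy, Pi.add_apply, mul_add]
      map_smul' := fun c g => by
        refine Subtype.ext (funext fun x => ?_)
        change ∫ y, (K x y - K o y) * (c • g : Lp ℂ ∞ (vertexMeasure m)) y ∂(vertexMeasure m) =
          c * ∫ y, (K x y - K o y) * g y ∂(vertexMeasure m)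
        rw [← integral_const_mul]
        refine integral_congr_ae ?_
        filter_upwards [Lp.coeFn_smul c g] with y hy
        rw [hy, Pi.smul_apply, smul_eq_mul]
        ring }
  refine ⟨S₀.mkContinuous B.toReal fun g => ?_, fun g => rfl⟩
  rw [BMOFun.norm_def]
  have h := ENNReal.toReal_mono (by finiteness) (hbd g)
  rwa [ENNReal.toReal_mul, toReal_enorm] at h

theorem bmoENorm_const (hm : T.IsFlow m) (hd : T.IsLocallyDoubling m) (β : ℝ) (t : ℂ) :
    bmoENorm T m β (fun _ => t) < ∞ := by
  refine (iSup₂_le (a := 0) fun R hR => ?_).trans_lt ENNReal.zero_lt_top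
  have h : R.Finite ∧ vertexMeasure m R ≠ 0 := by
    rcases hR with ⟨x, rfl⟩ | ⟨x, a, b, hab, rfl⟩
    · exact ⟨finite_singleton x, hm.measure_singleton_ne_zero x⟩
    · refine ⟨hm.finite_trapezoid hd x a b, ?_⟩
      rw [hm.measure_trapezoid hd]
      have := hab.2.1
      refine mul_ne_zero (by exact_mod_cast (by omega : b - a ≠ 0)) ?_
      simpa using hm.1 x
  refine (meanOscillation_le_of_const h.1 h.2 _ t).trans ?_
  simp

end BMO

/-! ### Assembly of the four statements. -/

theorem theoremt {V : Type*} [MeasurableSpace V] [DiscreteMeasurableSpace V]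
    (T : TreeAtInfinity V) (m : V → ℝ) (hm : T.IsFlow m) (hd : T.IsLocallyDoubling m)
    (β : ℝ) (hβ : 12 ≤ β)
    (A : Lp ℂ 2 (vertexMeasure m) →L[ℂ] Lp ℂ 2 (vertexMeasure m))
    (K : V → V → ℂ) (hK : HasKernel m A K) :
    (hormanderConst T m β K < ∞ →
      (∃ S : HardySpace T m β →L[ℂ] Lp ℂ 1 (vertexMeasure m),
        ∀ (f : Lp ℂ 2 (vertexMeasure m)) (g : HardySpace T m β),
          f =ᵐ[vertexMeasure m] HardySpace.toL1 g → A f =ᵐ[vertexMeasure m] S g) ∧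
      ∀ (p : ℝ≥0∞) [Fact (1 ≤ p)], 1 < p → p < 2 →
        ∃ S : Lp ℂ p (vertexMeasure m) →L[ℂ] Lp ℂ p (vertexMeasure m),
          ∀ (f : Lp ℂ 2 (vertexMeasure m)) (g : Lp ℂ p (vertexMeasure m)),
            f =ᵐ[vertexMeasure m] g → A f =ᵐ[vertexMeasure m] S g) ∧
    (hormanderConst T m β (fun x y => K y x) < ∞ →
      (∃ S : Lp ℂ ∞ (vertexMeasure m) →L[ℂ] BMO T m β,
        ∀ (f : Lp ℂ 2 (vertexMeasure m)) (g : Lp ℂ ∞ (vertexMeasure m)),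
          f =ᵐ[vertexMeasure m] g →
            ∃ F : BMOFun T m β, A f =ᵐ[vertexMeasure m] BMOFun.toFun F ∧
              S g = Submodule.Quotient.mk F) ∧
      ∀ (q : ℝ≥0∞) [Fact (1 ≤ q)], 2 < q → q < ∞ →
        ∃ S : Lp ℂ q (vertexMeasure m) →L[ℂ] Lp ℂ q (vertexMeasure m),
          ∀ (f : Lp ℂ 2 (vertexMeasure m)) (g : Lp ℂ q (vertexMeasure m)),
            f =ᵐ[vertexMeasure m] g → A f =ᵐ[vertexMeasure m] S g) := by
  have := hm.countable hd
  have : SFinite (vertexMeasure m) := by unfold vertexMeasure; infer_instance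
  have hfin := vertexMeasure_singleton_ne_top m
  have h0 := hm.measure_singleton_ne_zero
  have hrep := apply_eq_kernelOp hfin h0 hK
  have hcoin : ∀ {u v : V → ℂ} (f : Lp ℂ 2 (vertexMeasure m)), f =ᵐ[vertexMeasure m] u →
      v =ᵐ[vertexMeasure m] kernelOp (vertexMeasure m) K u → A f =ᵐ[vertexMeasure m] v := by
    intro u v f hfu hv
    filter_upwards [hv] with x hx
    rw [hx, (hrep x f).2, kernelOp_congr_ae hfu]
  have hN := isStrongTypeTwo_of_apply_eq hfin h0 hK
  have hNt : ‖A‖ₑ ^ 2 ≠ ∞ := by finiteness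
  refine ⟨fun hH => ⟨?_, fun p _ hp hp2 => ?_⟩, fun hH => ⟨?_, fun q _ hq hq' => ?_⟩⟩
  · obtain ⟨S, hS⟩ := exists_extension_hardySpace hm hd hβ hN hNt hH
    exact ⟨S, fun f g hfg => hcoin f hfg (hS g)⟩
  · obtain ⟨W, hW, hweak⟩ := hm.isWeakTypeOne hd hβ hN hNt hH
    have hpt : p ≠ ∞ := (hp2.trans_le le_top).ne
    have hp1' : 1 < p.toReal := by
      rw [← ENNReal.toReal_one]
      exact (ENNReal.toReal_lt_toReal ENNReal.one_ne_top hpt).2 hp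
    have hp2' : p.toReal < 2 := by
      rw [← ENNReal.toReal_ofNat]
      exact (ENNReal.toReal_lt_toReal hpt ENNReal.ofNat_ne_top).2 hp2
    have hs : IsStrongType (vertexMeasure m) K p.toReal _ := fun f hf =>
      hweak.lintegral_rpow_le hfin hN hp1' hp2' hf
    obtain ⟨S, hS⟩ := hs.exists_extension hfin h0 hp hpt (by finiteness)
    exact ⟨S, fun f g hfg => hcoin f hfg (hS g)⟩
  · obtain ⟨S, hS⟩ := exists_extension_bmo hm hd hβ hN hNt hH (T.ray 0)
    refine ⟨(BMOFun.constants T m β).mkQL.comp S, fun f g hfg => ?_⟩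
    -- For `f` in `L²` the rows can be integrated separately, and the normalization at `T.ray 0`
    -- differs from `A f` by the value of `A f` there.
    let c : BMOFun T m β := ⟨fun _ => kernelOp (vertexMeasure m) K f (T.ray 0),
      bmoENorm_const hm hd β _⟩
    refine ⟨S g + c, ae_of_all _ fun x => ?_, ?_⟩
    · rw [(hrep x f).2, map_add, hS]
      change _ = ∫ y, (K x y - K (T.ray 0) y) * g y ∂(vertexMeasure m) +
        kernelOp (vertexMeasure m) K f (T.ray 0)
      have h1 : ∫ y, (K x y - K (T.ray 0) y) * g y ∂(vertexMeasure m) =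
          ∫ y, (K x y * f y - K (T.ray 0) y * f y) ∂(vertexMeasure m) := by
        refine integral_congr_ae ?_
        filter_upwards [hfg] with y hy
        rw [hy]
        ring
      rw [h1, integral_sub (hrep x f).1 (hrep _ f).1]
      simp [kernelOp]
    · refine (Submodule.Quotient.eq _).2 ⟨-kernelOp (vertexMeasure m) K f (T.ray 0), ?_⟩
      change BMOFun.toFun (S g - (S g + c)) = _
      rw [sub_add_cancel_left, map_neg]
      rfl
  -- The transposed kernel is bounded on `L²` by duality and satisfies the first Hörmander
  -- condition. It is therefore bounded on `Lᵖ` for the exponent `p < 2` conjugate to `q`;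
  -- transposing again gives `K` on `L^q`.
  · have hN2 : IsStrongTypeTwo (vertexMeasure m) (fun x y => K y x) _ :=
      isStrongType_two_iff.1 ((isStrongType_two_iff.2 hN).transpose hfin .two_two)
    have hN2t : (‖A‖ₑ ^ 2) ^ ((2 : ℝ) / 2) ≠ ∞ :=
      ENNReal.rpow_ne_top_of_nonneg (by norm_num) hNt
    obtain ⟨W, hW, hweak⟩ := hm.isWeakTypeOne hd hβ hN2 hN2t hH
    have hq2 : 2 < q.toReal := by
      rw [← ENNReal.toReal_ofNat]
      exact (ENNReal.toReal_lt_toReal ENNReal.ofNat_ne_top hq'.ne).2 hq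
    have hpq := (Real.HolderConjugate.conjExponent (show 1 < q.toReal by linarith)).symm
    set p := q.toReal.conjExponent
    have hp2 : p < 2 := by
      simp only [p, Real.conjExponent]
      rw [div_lt_iff₀ (by linarith)]
      linarith
    have hs : IsStrongType (vertexMeasure m) (fun x y => K y x) p _ := fun f hf =>
      hweak.lintegral_rpow_le hfin hN2 hpq.lt hp2 hf
    have hs' := hs.transpose hfin hpq
    obtain ⟨S, hS⟩ := hs'.exists_extension (K := K) hfin h0 (ENNReal.one_lt_two.trans hq) hq'.ne
      (ENNReal.rpow_ne_top_of_nonneg (div_nonneg (by linarith) hpq.nonneg) (by finiteness))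
    exact ⟨S, fun f g hfg => hcoin f hfg (hS g)⟩
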